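/- Let $G=(V,E,A,\phi)$ be a finite undirected simple graph with edge lengths $A:E\to\mathbb R_{>0}$ and node weights $\phi:V\to\mathbb R_{>0}$, let $R$ be a finite non-empty set of robots with initial nodes $p_0=(p_{0,r})_{r\in R}\in V^R$, and let $T\in[0,\infty)$, $\Delta>0$, $\kappa\in\mathbb Z_{\ge1}$, $W=\{\Delta,2\Delta,\dots,\kappa\Delta\}$. **Discretized monitoring problem.** A joint strategy $\gamma=(\gamma_r)_{r\in R}$ with $\gamma_r:[0,\infty)\to|G|$ (the metric graph) is *admissible* if every $\gamma_r$ starts at $p_{0,r}$ and is an infinite concatenation of legs, each of which is the traversal of a full edge at unit speed or a wait at a node of a duration in $W$. The latency of $v$ at time $t$ is $t$ minus the last time in $[0,t]$ at which some robot was at $v$ (minus $0$ if there is none), $L^\gamma(t)$ is the maximum over $v$ of $\phi(v)$ times the latency of $v$ at time $t$, and $J_T(\gamma)=\sup_{t\ge T}L^\gamma(t)\in[0,\infty]$. The problem is to minimize $J_T$ over the admissible strategies. **The MDP $\mathcal M_\Delta$.** A state $s=(p,\boldsymbol L,z,\eta)$ consists of the current leg (start node, end node, remaining duration) of each robot, the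 latencies $(L_v)_{v\in V}$ of the nodes, a tracker $z$ and an elapsed time $\eta$. The initial state $s_0$ has all robots at $p_0$ with remaining duration $0$, and $\boldsymbol L=0$, $z=0$, $\eta=0$. In a state, each robot with remaining duration $0$ chooses to traverse an edge at its node or to wait there for a time in $W$; the other robots take a no-op action. The process then moves deterministically to the next event, which is the first time at which some robot completes its leg or the time $T$ is reached (if $\eta<T$): the remaining durations decrease by the elapsed time $\Delta t$; $L_v$ becomes $0$ if $v$ is visited after the current event and up to the next one, and $L_v+\Delta t$ otherwise; $\eta$ becomes $\min\{\eta+\Delta t,T\}$; and $z$ is updated so that at an event time $t_n$ it equals $\sup_{T\le t\le t_n}L(t)$ if $t_n\ge T$, and $0$ if $t_n<T$. That is, $z$ stays $0$ before $T$; it is $\max_v\phi(v)L_v$ (updated latencies) when $T$ is first reached; and from then on it becomes the maximum of $z$ and $\max_v\phi(v)\ell_v$, where $\ell_v=0$ if a robot waits at $v$ between the two events and $\ell_v=L_v+\Delta t$ (old $L_v$) otherwise. The reward of a state is $z$. For a stationary Markov policy $\mu$ (possibly randomized, supported on available actions), $J^{\mathrm{ave}}_{s_0}(\mu)=\lim_{N\to\infty}\frac1N\sum_{n=0}^{N-1}\mathbb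 E_\mu[z_n\mid s_0]\in[0,\infty]$; a policy is optimal if it minimizes $J^{\mathrm{ave}}_{s_0}$ over these policies. **Claim.** The limit that defines $J^{\mathrm{ave}}_{s_0}(\mu)$ exists for every stationary Markov policy $\mu$. Optimal stationary policies of $\mathcal M_\Delta$ and optimal admissible strategies exist, and $$\inf_\mu J^{\mathrm{ave}}_{s_0}(\mu)=\inf_{\gamma\text{ admissible}}J_T(\gamma).$$ Moreover: 1. If $\mu$ is an optimal stationary policy, then there are state-action trajectories from $s_0$ all of whose actions have positive probability under $\mu$, and every such trajectory describes exactly one joint strategy (obtained by concatenating its legs), which is an optimal admissible strategy. 2. If $\gamma$ is an optimal admissible strategy, then some state-action trajectory of $\mathcal M_\Delta$ from $s_0$ describes $\gamma$, and for every such trajectory $\xi$ there is an optimal stationary policy that, in every state occurring along $\xi$, takes with certainty one of the actions that $\xi$ takes in that state. -/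

import Mathlib

open scoped NNReal ENNReal

namespace Monitoring

noncomputable section

/-- A weighted graph: `length` is the length of an edge, `weight` the priority of a node. -/
structure WGraph (V : Type*) where
  graph : SimpleGraph V
  length : Sym2 V → ℝ≥0
  weight : V → ℝ≥0
  length_pos : ∀ e ∈ graph.edgeSet, 0 < length e
  weight_pos : ∀ v, 0 < weight v

/-! ### The geometric realization and joint strategies -/

open Classical in
/-- The node `v` as a point of the geometric realization (in barycentric coordinates). -/
def vertex {V : Type*} (v : V) : V → ℝ := Pi.single v 1

/-- The geometric realization of the graph: the union of its nodes and of its closed edges. -/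
def WGraph.Realization {V : Type*} (G : WGraph V) : Type _ :=
  {b : V → ℝ // (∃ v, b = vertex v) ∨
    ∃ u v, G.graph.Adj u v ∧ b ∈ segment ℝ (vertex u) (vertex v)}

/-- The point of the edge from `u` to `v` at distance `x` from the end `v`, distances along the
edge being measured by its length. For `u = v` this is the node `v`, whatever `x` is. -/
def WGraph.point {V : Type*} (G : WGraph V) (u v : V) (x : ℝ≥0) : V → ℝ :=
  AffineMap.lineMap (vertex v) (vertex u) (((x / G.length s(u, v) : ℝ≥0)) : ℝ)

/-- A joint behaviour of the robots `R`: their positions as functions of time. -/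
abbrev Strategy {V : Type*} (G : WGraph V) (R : Type*) : Type _ :=
  R → ℝ≥0 → G.Realization

/-- A leg of a robot, from node `src` to node `dst`, with a duration. It is an edge traversal, or
a wait if `src = dst`. Inside a state of the decision process, `dur` is the remaining duration. -/
structure Leg (V : Type*) where
  src : V
  dst : V
  dur : ℝ≥0

/-- The legs that a robot may perform when the set of waiting times is `W`: full edge traversals
at unit speed, and waits at nodes of a duration in `W`. -/
def WGraph.IsLeg {V : Type*} (G : WGraph V) (W : Set ℝ≥0) (l : Leg V) : Prop :=
  (G.graph.Adj l.src l.dst ∧ l.dur = G.length s(l.src, l.dst)) ∨ (l.dst = l.src ∧ l.dur ∈ W)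

/-- The time at which the `j`-th leg of a sequence of legs starts. -/
def legStart {V : Type*} (α : ℕ → Leg V) (j : ℕ) : ℝ≥0 := ∑ i ∈ Finset.range j, (α i).dur

/-- The rational strategies with waiting times in `W` and initial configuration `p₀`: every robot
performs, one after the other, a sequence of legs that starts at its initial node. -/
def rationalStrategies {V R : Type*} (G : WGraph V) (W : Set ℝ≥0) (p₀ : R → V) :
    Set (Strategy G R) :=
  {γ | ∀ r, ∃ α : ℕ → Leg V,
    (α 0).src = p₀ r ∧
    (∀ j, G.IsLeg W (α j)) ∧
    (∀ j, (α (j + 1)).src = (α j).dst) ∧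
    ∀ j t, legStart α j ≤ t → t ≤ legStart α (j + 1) →
      (γ r t).1 = G.point (α j).src (α j).dst (legStart α (j + 1) - t)}

/-- The discretized waiting times `Δ, 2Δ, …, κΔ`. -/
def waitSet (Δ : ℝ≥0) (κ : ℕ) : Set ℝ≥0 := {τ | ∃ k : ℕ, 1 ≤ k ∧ k ≤ κ ∧ τ = k * Δ}

/-! ### Latency and the tail objective -/

/-- The most recent visit of robot `r` to node `v` up to time `t`; it is `0` if there is none
(the supremum of the empty set in `ℝ≥0` is `0`). -/
def lastVisit {V R : Type*} {G : WGraph V} (γ : Strategy G R) (r : R) (v : V) (t : ℝ≥0) : ℝ≥0 :=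
  sSup {t' | t' ≤ t ∧ (γ r t').1 = vertex v}

/-- The latency of node `v` at time `t`. -/
def latency {V R : Type*} [Fintype R] {G : WGraph V} (γ : Strategy G R) (v : V) (t : ℝ≥0) :
    ℝ≥0 :=
  t - Finset.univ.sup fun r => lastVisit γ r v t

/-- The worst weighted latency at time `t`. -/
def worstLatency {V R : Type*} [Fintype V] [Fintype R] {G : WGraph V} (γ : Strategy G R)
    (t : ℝ≥0) : ℝ≥0 :=
  Finset.univ.sup fun v => G.weight v * latency γ v t

/-- The tail objective: the supremum of the worst weighted latency over the times `t ≥ T`. -/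
def tailObjective {V R : Type*} [Fintype V] [Fintype R] {G : WGraph V} (T : ℝ≥0)
    (γ : Strategy G R) : ℝ≥0∞ :=
  ⨆ t : ℝ≥0, ⨆ _ : T ≤ t, (worstLatency γ t : ℝ≥0∞)

/-- `γ` solves the monitoring problem over the rational strategies with waiting times in `W` that
start in `p₀`. -/
def IsOptimalStrategy {V R : Type*} [Fintype V] [Fintype R] (G : WGraph V) (T : ℝ≥0)
    (W : Set ℝ≥0) (p₀ : R → V) (γ : Strategy G R) : Prop :=
  γ ∈ rationalStrategies G W p₀ ∧
    ∀ γ' ∈ rationalStrategies G W p₀, tailObjective T γ ≤ tailObjective T γ'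

/-! ### The event-driven decision process -/

/-- A state at an event time: the current leg of every robot with its remaining duration, the
latencies of the nodes, the worst weighted latency observed since time `T`, and the elapsed time
(capped at `T`). -/
structure MState (V R : Type*) where
  pos : R → Leg V
  lat : V → ℝ≥0
  z : ℝ≥0
  η : ℝ≥0

/-- A joint action: for every robot a target node and a duration, or `none` (no-op). -/
abbrev JointAction (V R : Type*) : Type _ := R → Option (V × ℝ≥0)

/-- The actions available in a state: a robot that has completed its leg moves to a neighbour of
its current node or waits there for a time in `W`; every other robot takes the no-op action. -/
def Admissible {V R : Type*} (G : WGraph V) (W : Set ℝ≥0) (s : MState V R)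
    (a : JointAction V R) : Prop :=
  ∀ r, if (s.pos r).dur = 0 then
      ∃ v τ, a r = some (v, τ) ∧ G.IsLeg W ⟨(s.pos r).dst, v, τ⟩
    else a r = none

/-- The legs of the robots right after a joint action is applied. -/
def applyAction {V R : Type*} (s : MState V R) (a : JointAction V R) (r : R) : Leg V :=
  match a r with
  | some (v, τ) => ⟨(s.pos r).dst, v, τ⟩
  | none => s.pos r

/-- The time until the next event: some robot completes its leg, or time `T` is reached. -/
def eventGap {V R : Type*} [Fintype R] [Nonempty R] (T : ℝ≥0) (s : MState V R)
    (a : JointAction V R) : ℝ≥0 :=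
  let d := Finset.univ.inf' Finset.univ_nonempty fun r => (applyAction s a r).dur
  if s.η < T then min d (T - s.η) else d

open Classical in
/-- The latencies at the next event time. A node is visited after the current event time and up to
the next one iff a robot waits there meanwhile or completes a leg there at the next event. -/
def nextLat {V R : Type*} [Fintype R] [Nonempty R] (T : ℝ≥0) (s : MState V R)
    (a : JointAction V R) (v : V) : ℝ≥0 :=
  if ∃ r, (applyAction s a r).dst = v ∧
      ((applyAction s a r).src = v ∨ (applyAction s a r).dur = eventGap T s a) then 0
  else s.lat v + eventGap T s a

open Classical in
/-- The supremum of the latency of `v` between the current and the next event time. It is `0` if a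
robot waits at `v` meanwhile; otherwise it is the left limit at the next event time. -/
def peakLat {V R : Type*} [Fintype R] [Nonempty R] (T : ℝ≥0) (s : MState V R)
    (a : JointAction V R) (v : V) : ℝ≥0 :=
  if ∃ r, (applyAction s a r).src = v ∧ (applyAction s a r).dst = v then 0
  else s.lat v + eventGap T s a

/-- The (deterministic) transition. The tracker `z` is the supremum of the worst weighted latency
over the times from `T` up to the current event. So it stays `0` before `T`, is the worst weighted
latency at time `T` when `T` is reached, and later also takes in the peaks between events. -/
def step {V R : Type*} [Fintype V] [Fintype R] [Nonempty R] (G : WGraph V) (T : ℝ≥0)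
    (s : MState V R) (a : JointAction V R) : MState V R where
  pos r := ⟨(applyAction s a r).src, (applyAction s a r).dst,
    (applyAction s a r).dur - eventGap T s a⟩
  lat := nextLat T s a
  z :=
    if T ≤ s.η then max s.z (Finset.univ.sup fun v => G.weight v * peakLat T s a v)
    else if T ≤ s.η + eventGap T s a then Finset.univ.sup fun v => G.weight v * nextLat T s a v
    else 0
  η := min (s.η + eventGap T s a) T

/-- The initial state: all robots are at their initial nodes and ready to act. -/
def initState {V R : Type*} (p₀ : R → V) : MState V R where
  pos r := ⟨p₀ r, p₀ r, 0⟩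
  lat _ := 0
  z := 0
  η := 0

/-- A stationary Markov policy, possibly randomized: to each state it assigns a probability
distribution on the actions available there. -/
structure Policy {V : Type*} (R : Type*) (G : WGraph V) (W : Set ℝ≥0) where
  act : MState V R → PMF (JointAction V R)
  admissible : ∀ s, ∀ a ∈ (act s).support, Admissible G W s a

/-- The law of the `n`-th state under a policy, started in `initState p₀`. -/
def stateLaw {V R : Type*} [Fintype V] [Fintype R] [Nonempty R] (G : WGraph V) (T : ℝ≥0)
    {W : Set ℝ≥0} (p₀ : R → V) (μ : Policy R G W) : ℕ → PMF (MState V R)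
  | 0 => PMF.pure (initState p₀)
  | n + 1 => (stateLaw G T p₀ μ n).bind fun s => (μ.act s).map (step G T s)

/-- The expected reward of the `n`-th step; the reward in a state is its tracker value `z`. -/
def expReward {V R : Type*} [Fintype V] [Fintype R] [Nonempty R] (G : WGraph V) (T : ℝ≥0)
    {W : Set ℝ≥0} (p₀ : R → V) (μ : Policy R G W) (n : ℕ) : ℝ≥0∞ :=
  ∑' s, stateLaw G T p₀ μ n s * (s.z : ℝ≥0∞)

/-- The expected average reward over the first `N` steps. -/
def meanReward {V R : Type*} [Fintype V] [Fintype R] [Nonempty R] (G : WGraph V) (T : ℝ≥0)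
    {W : Set ℝ≥0} (p₀ : R → V) (μ : Policy R G W) (N : ℕ) : ℝ≥0∞ :=
  (∑ n ∈ Finset.range N, expReward G T p₀ μ n) / N

/-- The long-run average reward (a cost, to be minimized). -/
def avgReward {V R : Type*} [Fintype V] [Fintype R] [Nonempty R] (G : WGraph V) (T : ℝ≥0)
    {W : Set ℝ≥0} (p₀ : R → V) (μ : Policy R G W) : ℝ≥0∞ :=
  Filter.limsup (meanReward G T p₀ μ) Filter.atTop

/-- `μ` minimizes the long-run average reward among all stationary Markov policies. -/
def IsOptimalPolicy {V R : Type*} [Fintype V] [Fintype R] [Nonempty R] (G : WGraph V) (T : ℝ≥0)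
    {W : Set ℝ≥0} (p₀ : R → V) (μ : Policy R G W) : Prop :=
  ∀ μ' : Policy R G W, avgReward G T p₀ μ ≤ avgReward G T p₀ μ'

/-! ### Trajectories of the decision process and the strategies they describe -/

/-- A state-action trajectory of the decision process, started in `initState p₀`. -/
structure Trajectory {V R : Type*} [Fintype V] [Fintype R] [Nonempty R] (G : WGraph V) (T : ℝ≥0)
    (W : Set ℝ≥0) (p₀ : R → V) where
  state : ℕ → MState V R
  action : ℕ → JointAction V R
  init : state 0 = initState p₀
  admissible : ∀ n, Admissible G W (state n) (action n)
  next : ∀ n, state (n + 1) = step G T (state n) (action n)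

section

variable {V R : Type*} [Fintype V] [Fintype R] [Nonempty R] {G : WGraph V} {T : ℝ≥0}
  {W : Set ℝ≥0} {p₀ : R → V}

/-- The `n`-th event time. -/
def Trajectory.time (ξ : Trajectory G T W p₀) (n : ℕ) : ℝ≥0 :=
  ∑ i ∈ Finset.range n, eventGap T (ξ.state i) (ξ.action i)

/-- `ξ` describes the strategy `γ`: between two consecutive events every robot moves along its
current leg, at unit speed, or waits. -/
def Trajectory.Describes (ξ : Trajectory G T W p₀) (γ : Strategy G R) : Prop :=
  ∀ n r t, ξ.time n ≤ t → t ≤ ξ.time (n + 1) →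
    (γ r t).1 = G.point (applyAction (ξ.state n) (ξ.action n) r).src
      (applyAction (ξ.state n) (ξ.action n) r).dst
      ((applyAction (ξ.state n) (ξ.action n) r).dur - (t - ξ.time n))

/-- `ξ` is generated by the policy `μ`: every action has positive probability under `μ`. -/
def Trajectory.GeneratedBy (ξ : Trajectory G T W p₀) (μ : Policy R G W) : Prop :=
  ∀ n, ξ.action n ∈ (μ.act (ξ.state n)).support

/-- The policy `μ` is read off from `ξ`: in every state that occurs along `ξ`, it takes with
certainty one of the actions that `ξ` takes when it is in this state. -/
def Policy.ReadOffFrom (μ : Policy R G W) (ξ : Trajectory G T W p₀) : Prop :=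
  ∀ n, ∃ m, ξ.state m = ξ.state n ∧ μ.act (ξ.state n) = PMF.pure (ξ.action m)

end

end

end Monitoring

open Monitoring

namespace Monitoring

/-! ### Expectations and averages -/

section Averages

/-! Both problems are compared with one number, the `value` of the initial state: the limit, as k
grows, of the least tracker value attainable in k steps. The tracker never decreases along the
process, so under any policy the expected rewards increase and their averages tend to their supremum
(`tendsto_meanReward`).

Every trajectory has tracker supremum at least the value. Only finitely many actions are available
in a state, so some action always preserves the value (`exists_value_step_le`), and following such
actions attains it. Under a policy, the expected value after any number of steps is at most the
average reward (`expectation_value_le_avgReward`). Since the value cannot fall below its initial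
level, a policy that attains this level almost surely keeps the tracker at or below it, which makes
all its trajectories optimal (`z_le_value_init_of_mem_support`). Conversely, a policy that copies
actions of a trajectory stays among its states and costs at most its tracker supremum
(`exists_readOffFrom`).

The link with motion rests on the absence of accumulating events: leg durations have a positive
lower bound (`Trajectory.linear_growth`). Hence a trajectory describes exactly one strategy, and
this strategy is rational; conversely, feeding the robots the legs of a rational strategy yields a
trajectory that describes it. The tracker supremum is then the tail objective
(`Trajectory.Describes.tailObjective_eq`). The delicate point is that a latency drops on arrival, so
its supremum between two events may be only a left limit. -/

theorem tsum_bind_mul {α β : Type*} (p : PMF α) (q : α → PMF β) (f : β → ℝ≥0∞) :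
    ∑' b, p.bind q b * f b = ∑' a, p a * ∑' b, q a b * f b := by
  simp_rw [PMF.bind_apply, ← ENNReal.tsum_mul_right, ← ENNReal.tsum_mul_left]
  rw [ENNReal.tsum_comm]
  simp_rw [mul_assoc]

theorem tsum_pure_mul {α : Type*} (a : α) (f : α → ℝ≥0∞) :
    ∑' b, PMF.pure a b * f b = f a := by
  rw [tsum_eq_single a]
  · simp
  · intro b hb
    simp [PMF.pure_apply_of_ne _ _ hb]

theorem tsum_map_mul {α β : Type*} (p : PMF α) (g : α → β) (f : β → ℝ≥0∞) :
    ∑' b, p.map g b * f b = ∑' a, p a * f (g a) := by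
  rw [← PMF.bind_pure_comp, tsum_bind_mul]
  simp_rw [Function.comp_apply, tsum_pure_mul]

theorem tsum_mul_le_tsum_mul_of_support {α : Type*} (p : PMF α) {f g : α → ℝ≥0∞}
    (h : ∀ a ∈ p.support, f a ≤ g a) : ∑' a, p a * f a ≤ ∑' a, p a * g a := by
  refine ENNReal.tsum_le_tsum fun a => ?_
  by_cases ha : p a = 0
  · simp [ha]
  · exact mul_le_mul_right (h a ((p.mem_support_iff a).2 ha)) _

theorem tsum_mul_const {α : Type*} (p : PMF α) (c : ℝ≥0∞) : ∑' a, p a * c = c := by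
  rw [ENNReal.tsum_mul_right, p.tsum_coe, one_mul]

/-- The averages of a monotone sequence of extended nonnegative reals tend to its supremum. -/
theorem tendsto_average_of_monotone {x : ℕ → ℝ≥0∞} (hx : Monotone x) :
    Filter.Tendsto (fun N : ℕ => (∑ n ∈ Finset.range N, x n) / N) Filter.atTop
      (nhds (⨆ n, x n)) := by
  rw [tendsto_order]
  constructor
  · intro c hc
    obtain ⟨c', hcc', hc'⟩ := ENNReal.lt_iff_exists_nnreal_btwn.1 hc
    obtain ⟨m, hm⟩ := lt_iSup_iff.1 hc'
    -- From index m on every term exceeds c', so a partial sum falls short of N * c' by at most m *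
    -- c'. Division by N makes this deficit vanish.
    have key : ∀ N : ℕ, (N : ℝ≥0∞) * c' ≤ ∑ n ∈ Finset.range N, x n + m * c' := by
      intro N
      induction N with
      | zero => simp
      | succ N ih =>
        rcases lt_or_ge N m with h | h
        · have : ((N + 1 : ℕ) : ℝ≥0∞) * c' ≤ m * c' := by gcongr; exact h
          exact this.trans le_add_self
        · rw [Finset.sum_range_succ, add_right_comm, Nat.cast_succ, add_mul, one_mul]
          exact add_le_add ih (hm.le.trans (hx h))
    have hlim : Filter.Tendsto (fun N : ℕ => (c' : ℝ≥0∞) - m * c' * (N : ℝ≥0∞)⁻¹) Filter.atTop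
        (nhds ((c' : ℝ≥0∞) - m * c' * 0)) := by
      refine ENNReal.Tendsto.sub tendsto_const_nhds ?_ (Or.inl ENNReal.coe_ne_top)
      exact ENNReal.Tendsto.const_mul ENNReal.tendsto_inv_nat_nhds_zero
        (Or.inr (ENNReal.mul_ne_top (by simp) (by simp)))
    rw [mul_zero, tsub_zero] at hlim
    filter_upwards [hlim.eventually (lt_mem_nhds hcc'), Filter.eventually_gt_atTop 0] with N hN hN0
    refine hN.trans_le (tsub_le_iff_right.2 ?_)
    have h0 : (N : ℝ≥0∞) ≠ 0 := by exact_mod_cast hN0.ne'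
    rw [← ENNReal.div_eq_inv_mul.trans (mul_comm _ _), ENNReal.div_add_div_same,
      ENNReal.le_div_iff_mul_le (Or.inl h0) (Or.inl (by simp)), mul_comm]
    exact key N
  · intro c hc
    filter_upwards with N
    refine lt_of_le_of_lt (ENNReal.div_le_of_le_mul ?_) hc
    calc ∑ n ∈ Finset.range N, x n ≤ ∑ _n ∈ Finset.range N, ⨆ n, x n :=
          Finset.sum_le_sum fun n _ => le_iSup x n
      _ = (⨆ n, x n) * N := by simp [mul_comm]

end Averages

/-! ### Dynamic programming -/

section Actions

variable {V R : Type*} {G : WGraph V} {T : ℝ≥0} {W : Set ℝ≥0} {p₀ : R → V}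

theorem waitSet_finite (Δ : ℝ≥0) (κ : ℕ) : (waitSet Δ κ).Finite := by
  refine ((Set.finite_Iic κ).image fun k : ℕ => (k : ℝ≥0) * Δ).subset ?_
  rintro τ ⟨k, -, hk, rfl⟩
  exact ⟨k, hk, rfl⟩

theorem mem_waitSet {Δ : ℝ≥0} {κ : ℕ} (hκ : 1 ≤ κ) : Δ ∈ waitSet Δ κ :=
  ⟨1, le_rfl, hκ, by simp⟩

theorem exists_admissible (hW : W.Nonempty) (s : MState V R) : ∃ a, Admissible G W s a := by
  classical
  obtain ⟨τ, hτ⟩ := hW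
  refine ⟨fun r => if (s.pos r).dur = 0 then some ((s.pos r).dst, τ) else none, fun r => ?_⟩
  by_cases h : (s.pos r).dur = 0
  · simp only [h, if_true]
    exact ⟨_, τ, rfl, Or.inr ⟨rfl, hτ⟩⟩
  · simp only [h, if_false]

theorem finite_legDur [Fintype V] (hW : W.Finite) : {τ | ∃ l, G.IsLeg W l ∧ l.dur = τ}.Finite := by
  refine (hW.union (Set.finite_range G.length)).subset ?_
  rintro τ ⟨l, h | h, rfl⟩
  · exact Or.inr ⟨_, h.2.symm⟩
  · exact Or.inl h.2

theorem finite_admissible [Fintype V] [Fintype R] (hW : W.Finite) (s : MState V R) :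
    {a | Admissible G W s a}.Finite := by
  have hS := ((Set.finite_univ (α := V)).prod (finite_legDur (G := G) hW)).image some
  refine (Set.Finite.pi' fun _ : R => hS.insert none).subset fun a ha r => ?_
  have := ha r
  split_ifs at this
  · obtain ⟨v, τ, h, hl⟩ := this
    exact Or.inr ⟨(v, τ), ⟨trivial, _, hl, rfl⟩, h.symm⟩
  · exact Or.inl this

/-- The tracker has not been started before time `T`. -/
def TrackerOff (T : ℝ≥0) (s : MState V R) : Prop := s.η < T → s.z = 0

theorem trackerOff_initState : TrackerOff T (initState p₀) := fun _ => rfl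

end Actions

section DynamicProgramming

variable {V R : Type*} [Fintype V] [Fintype R] [Nonempty R] {G : WGraph V} {T : ℝ≥0}
  {W : Set ℝ≥0} {p₀ : R → V}

theorem trackerOff_step (s : MState V R) (a : JointAction V R) : TrackerOff T (step G T s a) := by
  intro h
  simp only [step, min_lt_iff, lt_self_iff_false, or_false] at h ⊢
  rw [if_neg (not_le.2 (lt_of_le_of_lt le_self_add h)), if_neg (not_le.2 h)]

/-- Before time `T` a transition discards the old tracker value, so monotonicity needs this value to
be 0 there. States reachable from the initial state satisfy this. -/
theorem z_le_step {s : MState V R} (hs : TrackerOff T s) (a : JointAction V R) :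
    s.z ≤ (step G T s a).z := by
  by_cases h : T ≤ s.η
  · simp [step, h]
  · rw [hs (not_le.1 h)]
    exact zero_le

/-- The least tracker value that can be reached within `k` steps. -/
noncomputable def valueIter (G : WGraph V) (T : ℝ≥0) (W : Set ℝ≥0) : ℕ → MState V R → ℝ≥0∞
  | 0, s => s.z
  | k + 1, s => ⨅ a ∈ {a | Admissible G W s a}, valueIter G T W k (step G T s a)

/-- The least supremum of the tracker along a trajectory that starts in the state `s`. -/
noncomputable def value (G : WGraph V) (T : ℝ≥0) (W : Set ℝ≥0) (s : MState V R) : ℝ≥0∞ :=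
  ⨆ k, valueIter G T W k s

theorem valueIter_succ_le {s : MState V R} {a : JointAction V R} (ha : Admissible G W s a)
    (k : ℕ) : valueIter G T W (k + 1) s ≤ valueIter G T W k (step G T s a) :=
  iInf₂_le a ha

theorem valueIter_le_succ {s : MState V R} (hs : TrackerOff T s) (k : ℕ) :
    valueIter G T W k s ≤ valueIter G T W (k + 1) s := by
  induction k generalizing s with
  | zero => exact le_iInf₂ fun a _ => ENNReal.coe_le_coe.2 (z_le_step hs a)
  | succ k ih => exact iInf₂_mono fun a _ => ih (trackerOff_step s a)

theorem valueIter_monotone {s : MState V R} (hs : TrackerOff T s) :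
    Monotone fun k => valueIter G T W k s :=
  monotone_nat_of_le_succ (valueIter_le_succ hs)

theorem z_le_value (s : MState V R) : (s.z : ℝ≥0∞) ≤ value G T W s :=
  le_iSup (fun k => valueIter G T W k s) 0

theorem value_le_step {s : MState V R} (hs : TrackerOff T s) {a : JointAction V R}
    (ha : Admissible G W s a) : value G T W s ≤ value G T W (step G T s a) :=
  iSup_le fun k => (valueIter_le_succ hs k).trans
    ((valueIter_succ_le ha k).trans (le_iSup (fun k => valueIter G T W k (step G T s a)) k))

/-- By finite branching, the value is kept by some action. -/
theorem exists_value_step_le (hW : W.Finite) (hW' : W.Nonempty) (s : MState V R) :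
    ∃ a, Admissible G W s a ∧ value G T W (step G T s a) ≤ value G T W s := by
  by_contra! hcon
  have hfin := finite_admissible (G := G) hW s
  -- If every action raised the value, each would do so at some finite horizon. As there are
  -- finitely many actions, one horizon K serves them all, and the best action at horizon K
  -- contradicts the bound on horizon K + 1.
  have h1 : ∀ a, ∃ k, Admissible G W s a → value G T W s < valueIter G T W k (step G T s a) := by
    intro a
    by_cases ha : Admissible G W s a
    · obtain ⟨k, hk⟩ := lt_iSup_iff.1 (hcon a ha)
      exact ⟨k, fun _ => hk⟩
    · exact ⟨0, fun h => absurd h ha⟩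
  choose k hk using h1
  obtain ⟨K, hK⟩ := (hfin.image k).bddAbove
  obtain ⟨a, ha, hmin⟩ := Set.exists_min_image _ (fun a => valueIter G T W K (step G T s a)) hfin
    (exists_admissible hW' s)
  have h2 : value G T W s < valueIter G T W K (step G T s a) :=
    (hk a ha).trans_le (valueIter_monotone (trackerOff_step s a) (hK ⟨a, ha, rfl⟩))
  have h3 : valueIter G T W K (step G T s a) ≤ valueIter G T W (K + 1) s := le_iInf₂ hmin
  exact absurd (h2.trans_le (h3.trans (le_iSup (fun k => valueIter G T W k s) (K + 1))))
    (lt_irrefl _)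

/-! ### Trajectories and the value -/

/-- Following a choice of admissible actions from the initial state. -/
noncomputable def Trajectory.ofChoice (p₀ : R → V) (f : MState V R → JointAction V R)
    (hf : ∀ s, Admissible G W s (f s)) : Trajectory G T W p₀ where
  state n := (fun s => step G T s (f s))^[n] (initState p₀)
  action n := f ((fun s => step G T s (f s))^[n] (initState p₀))
  init := rfl
  admissible _ := hf _
  next n := Function.iterate_succ_apply' _ n _

/-- The actions of the trajectory are competitors in the nested infima that define the iterates. -/
theorem Trajectory.value_init_le (ξ : Trajectory G T W p₀) :
    value G T W (initState p₀) ≤ ⨆ n, ((ξ.state n).z : ℝ≥0∞) := by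
  have h : ∀ k n, valueIter G T W k (ξ.state n) ≤ (ξ.state (n + k)).z := by
    intro k
    induction k with
    | zero => exact fun n => le_rfl
    | succ k ih =>
      intro n
      refine (valueIter_succ_le (ξ.admissible n) k).trans ?_
      rw [← ξ.next, ← add_assoc, add_right_comm]
      exact ih (n + 1)
  refine iSup_le fun k => ?_
  rw [← ξ.init]
  exact (h k 0).trans (le_iSup (fun n => ((ξ.state n).z : ℝ≥0∞)) (0 + k))

theorem exists_trajectory_le_value (hW : W.Finite) (hW' : W.Nonempty) (p₀ : R → V) :
    ∃ ξ : Trajectory G T W p₀, ⨆ n, ((ξ.state n).z : ℝ≥0∞) ≤ value G T W (initState p₀) := by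
  choose f hf hle using exists_value_step_le (V := V) (R := R) (G := G) (T := T) hW hW'
  refine ⟨Trajectory.ofChoice p₀ f hf, iSup_le fun n => (z_le_value (G := G) (T := T) (W := W)
    _).trans ?_⟩
  induction n with
  | zero => exact le_rfl
  | succ n ih =>
    rw [Trajectory.next]
    exact (hle _).trans ih

/-! ### Policies and the value -/

theorem trackerOff_and_value_le_of_mem_support (μ : Policy R G W) {n : ℕ}
    {s : MState V R} (hs : s ∈ (stateLaw G T p₀ μ n).support) :
    TrackerOff T s ∧ value G T W (initState p₀) ≤ value G T W s := by
  induction n generalizing s with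
  | zero =>
    rw [stateLaw, PMF.mem_support_pure_iff] at hs
    rw [hs]
    exact ⟨trackerOff_initState, le_rfl⟩
  | succ n ih =>
    simp only [stateLaw, PMF.mem_support_bind_iff, PMF.mem_support_map_iff] at hs
    obtain ⟨s', hs', a, ha, rfl⟩ := hs
    exact ⟨trackerOff_step _ _, (ih hs').2.trans
      (value_le_step (ih hs').1 (μ.admissible s' a ha))⟩

theorem expectation_succ (μ : Policy R G W) (n : ℕ) (f : MState V R → ℝ≥0∞) :
    ∑' s, stateLaw G T p₀ μ (n + 1) s * f s =
      ∑' s, stateLaw G T p₀ μ n s * ∑' a, μ.act s a * f (step G T s a) := by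
  simp only [stateLaw, tsum_bind_mul, tsum_map_mul]

theorem expReward_monotone (μ : Policy R G W) : Monotone (expReward G T p₀ μ) := by
  refine monotone_nat_of_le_succ fun n => ?_
  rw [expReward, expReward, expectation_succ]
  refine tsum_mul_le_tsum_mul_of_support _ fun s hs => ?_
  rw [← tsum_mul_const (μ.act s) (s.z : ℝ≥0∞)]
  exact tsum_mul_le_tsum_mul_of_support _ fun a _ =>
    ENNReal.coe_le_coe.2 (z_le_step (trackerOff_and_value_le_of_mem_support μ hs).1 a)

theorem tendsto_meanReward (μ : Policy R G W) : Filter.Tendsto (meanReward G T p₀ μ) Filter.atTop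
    (nhds (⨆ n, expReward G T p₀ μ n)) :=
  tendsto_average_of_monotone (expReward_monotone μ)

theorem avgReward_eq_iSup (μ : Policy R G W) :
    avgReward G T p₀ μ = ⨆ n, expReward G T p₀ μ n :=
  (tendsto_meanReward μ).limsup_eq

/-- One horizon step is traded for one step of the process: an infimum over actions is at most the
policy's average over them. -/
theorem expectation_valueIter_le_avgReward (μ : Policy R G W) (n k : ℕ) :
    ∑' s, stateLaw G T p₀ μ n s * valueIter G T W k s ≤ avgReward G T p₀ μ := by
  induction k generalizing n with
  | zero =>
    rw [avgReward_eq_iSup]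
    exact le_iSup (expReward G T p₀ μ) n
  | succ k ih =>
    refine le_trans ?_ (ih (n + 1))
    rw [expectation_succ]
    refine tsum_mul_le_tsum_mul_of_support _ fun s _ => ?_
    rw [← tsum_mul_const (μ.act s) (valueIter G T W (k + 1) s)]
    exact tsum_mul_le_tsum_mul_of_support _ fun a ha =>
      valueIter_succ_le (μ.admissible s a ha) k

theorem value_init_le_avgReward (μ : Policy R G W) :
    value G T W (initState p₀) ≤ avgReward G T p₀ μ := by
  refine iSup_le fun k => ?_
  have := expectation_valueIter_le_avgReward (p₀ := p₀) (T := T) μ 0 k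
  rwa [stateLaw, tsum_pure_mul] at this

/-- Monotone convergence in the horizon. The iterates are known to be monotone only on the support
of the law; elsewhere the terms vanish. -/
theorem expectation_value_le_avgReward (μ : Policy R G W) (n : ℕ) :
    ∑' s, stateLaw G T p₀ μ n s * value G T W s ≤ avgReward G T p₀ μ := by
  classical
  rw [ENNReal.tsum_eq_iSup_sum]
  refine iSup_le fun F => ?_
  have h1 : ∀ s ∈ F, stateLaw G T p₀ μ n s * value G T W s =
      ⨆ k, stateLaw G T p₀ μ n s * valueIter G T W k s := fun s _ => ENNReal.mul_iSup ..
  rw [Finset.sum_congr rfl h1, ENNReal.finsetSum_iSup_of_monotone]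
  · exact iSup_le fun k => (ENNReal.sum_le_tsum F).trans
      (expectation_valueIter_le_avgReward μ n k)
  · intro s k l hkl
    by_cases hs : s ∈ (stateLaw G T p₀ μ n).support
    · exact mul_le_mul_right
        (valueIter_monotone (trackerOff_and_value_le_of_mem_support μ hs).1 hkl) _
    · simp [(PMF.apply_eq_zero_iff _ _).2 hs]

/-- Under a policy that attains the value, no tracker value above it has positive probability. -/
theorem z_le_value_init_of_mem_support {μ : Policy R G W}
    (hμ : avgReward G T p₀ μ ≤ value G T W (initState p₀)) {n : ℕ} {s : MState V R}
    (hs : s ∈ (stateLaw G T p₀ μ n).support) : (s.z : ℝ≥0∞) ≤ value G T W (initState p₀) := by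
  by_contra! hlt
  -- The value is at least its initial level on the support and strictly larger at `s`, so its
  -- expectation would strictly exceed that level. The level is finite because it lies below `s.z`.
  have h := ENNReal.tsum_lt_tsum (i := s)
    (f := fun s => stateLaw G T p₀ μ n s * value G T W (initState p₀))
    (g := fun s => stateLaw G T p₀ μ n s * value G T W s)
    (by rw [tsum_mul_const]; exact hlt.ne_top)
    (fun s' => by
      by_cases hs' : s' ∈ (stateLaw G T p₀ μ n).support
      · exact mul_le_mul_right (trackerOff_and_value_le_of_mem_support μ hs').2 _
      · simp [(PMF.apply_eq_zero_iff _ _).2 hs'])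
    (ENNReal.mul_lt_mul_right ((PMF.mem_support_iff _ _).1 hs) (PMF.apply_ne_top _ _)
      (hlt.trans_le (z_le_value s)))
  rw [tsum_mul_const] at h
  exact absurd (h.trans_le ((expectation_value_le_avgReward μ n).trans hμ)) (lt_irrefl _)

theorem avgReward_le_of_support {μ : Policy R G W} {c : ℝ≥0∞}
    (h : ∀ n, ∀ s ∈ (stateLaw G T p₀ μ n).support, (s.z : ℝ≥0∞) ≤ c) :
    avgReward G T p₀ μ ≤ c := by
  rw [avgReward_eq_iSup]
  refine iSup_le fun n => ?_
  rw [← tsum_mul_const (stateLaw G T p₀ μ n) c]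
  exact tsum_mul_le_tsum_mul_of_support _ (h n)

/-! ### Trajectories and policies -/

theorem exists_generatedBy (p₀ : R → V) (T : ℝ≥0) (μ : Policy R G W) :
    ∃ ξ : Trajectory G T W p₀, ξ.GeneratedBy μ := by
  choose f hf using fun s => (μ.act s).support_nonempty
  exact ⟨Trajectory.ofChoice p₀ f fun s => μ.admissible s _ (hf s), fun n => hf _⟩

theorem Trajectory.GeneratedBy.state_mem_support {ξ : Trajectory G T W p₀} {μ : Policy R G W}
    (h : ξ.GeneratedBy μ) (n : ℕ) : ξ.state n ∈ (stateLaw G T p₀ μ n).support := by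
  induction n with
  | zero => rw [ξ.init, stateLaw, PMF.mem_support_pure_iff]
  | succ n ih =>
    simp only [stateLaw, PMF.mem_support_bind_iff, PMF.mem_support_map_iff]
    exact ⟨_, ih, _, h n, (ξ.next n).symm⟩

/-- A policy that repeats actions of a trajectory never leaves the states of the trajectory. -/
theorem exists_readOffFrom (hW' : W.Nonempty) (ξ : Trajectory G T W p₀) :
    ∃ μ : Policy R G W, μ.ReadOffFrom ξ ∧
      avgReward G T p₀ μ ≤ ⨆ n, ((ξ.state n).z : ℝ≥0∞) := by
  classical
  choose f hf using exists_admissible (V := V) (R := R) (G := G) hW'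
  let μ : Policy R G W :=
    -- A trajectory may act differently on repeated visits to a state; one visit is selected per
    -- state, so that the policy is stationary.
    { act := fun s => PMF.pure (if h : ∃ n, ξ.state n = s then ξ.action h.choose else f s)
      admissible := by
        intro s a ha
        rw [PMF.mem_support_pure_iff] at ha
        subst ha
        split_ifs with h
        · have := ξ.admissible h.choose
          rwa [h.choose_spec] at this
        · exact hf s }
  have hread : μ.ReadOffFrom ξ := by
    intro n
    have h : ∃ m, ξ.state m = ξ.state n := ⟨n, rfl⟩
    exact ⟨h.choose, h.choose_spec, by simp only [μ, dif_pos h]⟩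
  have hstates : ∀ n, ∀ s ∈ (stateLaw G T p₀ μ n).support, ∃ m, ξ.state m = s := by
    intro n
    induction n with
    | zero =>
      intro s hs
      rw [stateLaw, PMF.mem_support_pure_iff] at hs
      exact ⟨0, hs ▸ ξ.init⟩
    | succ n ih =>
      intro s hs
      simp only [stateLaw, PMF.mem_support_bind_iff, PMF.mem_support_map_iff] at hs
      obtain ⟨s', hs', a, ha, rfl⟩ := hs
      obtain ⟨m, rfl⟩ := ih s' hs'
      -- The copied action belongs to visit l, so the process continues at index l + 1, whichever
      -- visit m it came from.
      obtain ⟨l, hl, hact⟩ := hread m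
      rw [hact, PMF.mem_support_pure_iff] at ha
      exact ⟨l + 1, by rw [ξ.next, hl, ha]⟩
  refine ⟨μ, hread, avgReward_le_of_support fun n s hs => ?_⟩
  obtain ⟨m, rfl⟩ := hstates n s hs
  exact le_iSup (fun n => ((ξ.state n).z : ℝ≥0∞)) m

end DynamicProgramming


/-! ### Points of the geometric realization -/

section Points

variable {V : Type*} {G : WGraph V} {W : Set ℝ≥0}

theorem vertex_apply_self (v : V) : vertex v v = 1 := by simp [vertex]

theorem vertex_apply_of_ne {u v : V} (h : u ≠ v) : vertex v u = 0 := by simp [vertex, h]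

theorem point_self (u : V) (x : ℝ≥0) : G.point u u x = vertex u := by
  simp [WGraph.point]

theorem point_zero (u v : V) : G.point u v 0 = vertex v := by
  simp [WGraph.point]

theorem WGraph.length_pos_of_adj (G : WGraph V) {u v : V} (h : G.graph.Adj u v) :
    0 < G.length s(u, v) :=
  G.length_pos _ ((SimpleGraph.mem_edgeSet _).2 h)

theorem point_length {u v : V} (h : G.graph.Adj u v) :
    G.point u v (G.length s(u, v)) = vertex u := by
  simp [WGraph.point, div_self (G.length_pos_of_adj h).ne']

theorem WGraph.IsLeg.point_dur {l : Leg V} (h : G.IsLeg W l) :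
    G.point l.src l.dst l.dur = vertex l.src := by
  rcases h with h | h
  · rw [h.2, point_length h.1]
  · rw [h.1, point_self]

theorem WGraph.IsLeg.point_mem {l : Leg V} (h : G.IsLeg W l) {x : ℝ≥0} (hx : x ≤ l.dur) :
    (∃ v, G.point l.src l.dst x = vertex v) ∨
      ∃ u v, G.graph.Adj u v ∧ G.point l.src l.dst x ∈ segment ℝ (vertex u) (vertex v) := by
  rcases h with h | h
  -- Remaining distance is measured from the target, hence the reversed edge.
  · refine Or.inr ⟨l.dst, l.src, h.1.symm, ?_⟩
    rw [segment_eq_image_lineMap]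
    refine ⟨_, ⟨NNReal.coe_nonneg _, ?_⟩, rfl⟩
    rw [h.2] at hx
    exact_mod_cast div_le_one_of_le₀ hx zero_le
  · exact Or.inl ⟨l.src, by rw [h.1, point_self]⟩

theorem point_eq_vertex_iff {u w v : V} (h : G.graph.Adj u w) {x : ℝ≥0} :
    G.point u w x = vertex v ↔ (x = 0 ∧ v = w) ∨ (x = G.length s(u, w) ∧ v = u) := by
  constructor
  · intro hp
    -- The coordinate at v suffices: it must be 1, whereas it is 0 if v is not an end of the edge.
    have hv := congrFun hp v
    have hne := h.ne
    have hlen := G.length_pos_of_adj h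
    simp only [WGraph.point, AffineMap.lineMap_apply_module, Pi.add_apply, Pi.smul_apply,
      smul_eq_mul, vertex_apply_self] at hv
    by_cases hvw : v = w
    · subst hvw
      rw [vertex_apply_self, vertex_apply_of_ne hne.symm] at hv
      have : x / G.length s(u, v) = 0 := by
        rw [← NNReal.coe_inj]; push_cast at hv ⊢; linarith
      exact Or.inl ⟨by simpa [hlen.ne'] using this, rfl⟩
    by_cases hvu : v = u
    · subst hvu
      rw [vertex_apply_self, vertex_apply_of_ne hne] at hv
      have : x / G.length s(v, w) = 1 := by
        rw [← NNReal.coe_inj]; push_cast at hv ⊢; linarith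
      exact Or.inr ⟨(div_eq_one_iff_eq hlen.ne').1 this, rfl⟩
    · rw [vertex_apply_of_ne hvw, vertex_apply_of_ne hvu] at hv
      simp at hv
  · rintro (⟨rfl, rfl⟩ | ⟨rfl, rfl⟩)
    · exact point_zero _ _
    · exact point_length h

theorem WGraph.IsLeg.dur_pos (hpos : ∀ τ ∈ W, 0 < τ) {l : Leg V} (h : G.IsLeg W l) :
    0 < l.dur := by
  rcases h with h | h
  · rw [h.2]; exact G.length_pos_of_adj h.1
  · exact hpos _ h.2

theorem exists_legDur_bounds [Fintype V] (hW : W.Finite) (hpos : ∀ τ ∈ W, 0 < τ) :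
    ∃ δ D : ℝ≥0, 0 < δ ∧ ∀ l, G.IsLeg W l → δ ≤ l.dur ∧ l.dur ≤ D := by
  have hfin := finite_legDur (G := G) hW
  obtain ⟨D, hD⟩ := hfin.bddAbove
  rcases Set.eq_empty_or_nonempty {τ | ∃ l, G.IsLeg W l ∧ l.dur = τ} with he | hne
  -- Without any legs the bounds are vacuous.
  · refine ⟨1, D, one_pos, fun l hl =>
      absurd he (Set.nonempty_iff_ne_empty.1 ⟨l.dur, l, hl, rfl⟩)⟩
  · obtain ⟨δ, ⟨l, hl, rfl⟩, hmin⟩ := Set.exists_min_image _ id hfin hne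
    exact ⟨l.dur, D, hl.dur_pos hpos, fun l' hl' => ⟨hmin _ ⟨l', hl', rfl⟩, hD ⟨l', hl', rfl⟩⟩⟩

end Points

/-! ### Events along a trajectory -/

theorem eventGap_le {V R : Type*} [Fintype R] [Nonempty R] (T : ℝ≥0) (s : MState V R)
    (a : JointAction V R) (r : R) : eventGap T s a ≤ (applyAction s a r).dur := by
  have h : Finset.univ.inf' Finset.univ_nonempty (fun r => (applyAction s a r).dur) ≤
      (applyAction s a r).dur := Finset.inf'_le _ (Finset.mem_univ r)
  simp only [eventGap]
  split_ifs
  · exact (min_le_left _ _).trans h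
  · exact h

namespace Trajectory

variable {V R : Type*} [Fintype V] [Fintype R] [Nonempty R] {G : WGraph V} {T : ℝ≥0}
  {W : Set ℝ≥0} {p₀ : R → V} (ξ : Trajectory G T W p₀)

/-- The leg that robot `r` performs after the `n`-th event, with its remaining duration. -/
def leg (n : ℕ) (r : R) : Leg V := applyAction (ξ.state n) (ξ.action n) r

/-- The time between the events `n` and `n + 1`. -/
noncomputable def gap (n : ℕ) : ℝ≥0 := eventGap T (ξ.state n) (ξ.action n)

/-- Robot `r` chooses a new leg at the `n`-th event. -/
def Ready (n : ℕ) (r : R) : Prop := ((ξ.state n).pos r).dur = 0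

theorem time_zero : ξ.time 0 = 0 := by simp [time]

theorem time_succ (n : ℕ) : ξ.time (n + 1) = ξ.time n + ξ.gap n := by
  simp [time, gap, Finset.sum_range_succ]

theorem ready_zero (r : R) : ξ.Ready 0 r := by
  simp [Ready, ξ.init, initState]

theorem pos_succ (n : ℕ) (r : R) : (ξ.state (n + 1)).pos r =
    ⟨(ξ.leg n r).src, (ξ.leg n r).dst, (ξ.leg n r).dur - ξ.gap n⟩ := by
  rw [ξ.next]; rfl

variable {ξ}

theorem Ready.leg_src {n : ℕ} {r : R} (h : ξ.Ready n r) :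
    (ξ.leg n r).src = ((ξ.state n).pos r).dst := by
  have := ξ.admissible n r
  rw [if_pos (show ((ξ.state n).pos r).dur = 0 from h)] at this
  obtain ⟨v, τ, ha, -⟩ := this
  simp [leg, applyAction, ha]

theorem Ready.isLeg {n : ℕ} {r : R} (h : ξ.Ready n r) : G.IsLeg W (ξ.leg n r) := by
  have := ξ.admissible n r
  rw [if_pos (show ((ξ.state n).pos r).dur = 0 from h)] at this
  obtain ⟨v, τ, ha, hl⟩ := this
  simpa [leg, applyAction, ha] using hl

variable (ξ)

theorem leg_of_not_ready {n : ℕ} {r : R} (h : ¬ ξ.Ready n r) :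
    ξ.leg n r = (ξ.state n).pos r := by
  have := ξ.admissible n r
  rw [if_neg (show ¬ ((ξ.state n).pos r).dur = 0 from h)] at this
  simp [leg, applyAction, this]

theorem gap_le_dur (n : ℕ) (r : R) : ξ.gap n ≤ (ξ.leg n r).dur := eventGap_le _ _ _ _

theorem gap_eq (n : ℕ) : (∃ r, ξ.gap n = (ξ.leg n r).dur) ∨
    ((ξ.state n).η < T ∧ ξ.gap n = T - (ξ.state n).η) := by
  obtain ⟨r, -, hr⟩ := Finset.exists_mem_eq_inf' Finset.univ_nonempty
      (fun r => (applyAction (ξ.state n) (ξ.action n) r).dur)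
  simp only [gap, eventGap, hr]
  split_ifs with h
  · rcases le_total (applyAction (ξ.state n) (ξ.action n) r).dur (T - (ξ.state n).η) with h' | h'
    · exact Or.inl ⟨r, min_eq_left h'⟩
    · exact Or.inr ⟨h, min_eq_right h'⟩
  · exact Or.inl ⟨r, rfl⟩

theorem gap_le_of_lt {n : ℕ} (h : (ξ.state n).η < T) : (ξ.state n).η + ξ.gap n ≤ T := by
  simp only [gap, eventGap, if_pos h]
  exact (add_le_add_right (min_le_right _ _) _).trans (add_tsub_cancel_of_le h.le).le

theorem elapsed_eq (n : ℕ) : (ξ.state n).η = min (ξ.time n) T := by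
  induction n with
  | zero => simp [ξ.init, initState, time_zero]
  | succ n ih =>
    rw [ξ.next, time_succ]
    simp only [step]
    change min ((ξ.state n).η + ξ.gap n) T = _
    rw [ih]
    rcases le_total (ξ.time n) T with h | h
    · rw [min_eq_left h]
    · rw [min_eq_right h, min_eq_right le_self_add, min_eq_right (h.trans le_self_add)]

/-- A remaining leg is the end of a full leg. -/
theorem exists_isLeg (n : ℕ) (r : R) : ∃ l, G.IsLeg W l ∧ l.src = (ξ.leg n r).src ∧
    l.dst = (ξ.leg n r).dst ∧ (ξ.leg n r).dur ≤ l.dur := by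
  induction n with
  | zero => exact ⟨_, (ξ.ready_zero r).isLeg, rfl, rfl, le_rfl⟩
  | succ n ih =>
    by_cases h : ξ.Ready (n + 1) r
    · exact ⟨_, h.isLeg, rfl, rfl, le_rfl⟩
    · rw [ξ.leg_of_not_ready h, ξ.pos_succ]
      obtain ⟨l, hl, h1, h2, h3⟩ := ih
      exact ⟨l, hl, h1, h2, tsub_le_self.trans h3⟩

theorem leg_dur_pos (hpos : ∀ τ ∈ W, 0 < τ) (n : ℕ) (r : R) : 0 < (ξ.leg n r).dur := by
  by_cases h : ξ.Ready n r
  · exact h.isLeg.dur_pos hpos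
  · rw [ξ.leg_of_not_ready h]
    exact pos_iff_ne_zero.2 h

theorem gap_pos (hpos : ∀ τ ∈ W, 0 < τ) (n : ℕ) : 0 < ξ.gap n := by
  rcases ξ.gap_eq n with ⟨r, h⟩ | ⟨h, h'⟩
  · rw [h]; exact ξ.leg_dur_pos hpos n r
  · rw [h']; exact tsub_pos_of_lt h

theorem time_strictMono (hpos : ∀ τ ∈ W, 0 < τ) : StrictMono ξ.time :=
  strictMono_nat_of_lt_succ fun n => by
    rw [time_succ]; exact lt_add_of_pos_right _ (ξ.gap_pos hpos n)

theorem time_monotone : Monotone ξ.time :=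
  monotone_nat_of_le_succ fun n => by rw [time_succ]; exact le_self_add

/-- An event at which no robot finishes can only be the arrival at time `T`, which happens at most
once. -/
theorem exists_ready_or (n : ℕ) : (∃ r, ξ.Ready (n + 1) r) ∨
    ((ξ.state n).η < T ∧ T ≤ (ξ.state (n + 1)).η) := by
  rcases ξ.gap_eq n with ⟨r, h⟩ | ⟨h, h'⟩
  · exact Or.inl ⟨r, by rw [Ready, ξ.pos_succ]; simp [h]⟩
  · refine Or.inr ⟨h, ?_⟩
    rw [ξ.next]
    change T ≤ min ((ξ.state n).η + ξ.gap n) T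
    rw [h', add_tsub_cancel_of_le h.le, min_self]

/-- The total duration of the legs that have been started increases at least linearly. -/
theorem linear_growth {δ : ℝ≥0} (hδ : ∀ l, G.IsLeg W l → δ ≤ l.dur) (n : ℕ) :
    n * δ ≤ Fintype.card R * ξ.time n + ∑ r, ((ξ.state n).pos r).dur + 2 * δ := by
  classical
  -- The first two terms are the total duration of the legs started so far. The other two are
  -- credits: δ for a leg about to start, and δ for the single event caused by reaching `T`.
  have key : n * δ ≤ Fintype.card R * ξ.time n + ∑ r, ((ξ.state n).pos r).dur +
      (if ∃ r, ξ.Ready n r then δ else 0) + (if T ≤ (ξ.state n).η then δ else 0) := by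
    induction n with
    | zero => simp
    | succ n ih =>
      have hS : Fintype.card R * ξ.time (n + 1) + ∑ r, ((ξ.state (n + 1)).pos r).dur =
          Fintype.card R * ξ.time n + ∑ r, (ξ.leg n r).dur := by
        have : ∑ r, (ξ.leg n r).dur = ∑ r, ((ξ.state (n + 1)).pos r).dur +
            Fintype.card R * ξ.gap n := by
          have h : ∀ r, (ξ.leg n r).dur = ((ξ.state (n + 1)).pos r).dur + ξ.gap n := fun r => by
            rw [ξ.pos_succ]; exact (tsub_add_cancel_of_le (ξ.gap_le_dur n r)).symm
          simp_rw [h, Finset.sum_add_distrib]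
          simp
        rw [this, time_succ]; ring
      have hle : ∀ r, ((ξ.state n).pos r).dur ≤ (ξ.leg n r).dur := fun r => by
        by_cases h : ξ.Ready n r
        · rw [show ((ξ.state n).pos r).dur = 0 from h]; exact zero_le
        · rw [ξ.leg_of_not_ready h]
      have hact : ∑ r, ((ξ.state n).pos r).dur + (if ∃ r, ξ.Ready n r then δ else 0) ≤
          ∑ r, (ξ.leg n r).dur := by
        split_ifs with h
        · obtain ⟨r₀, h₀⟩ := h
          rw [← Finset.add_sum_erase _ _ (Finset.mem_univ r₀),
            ← Finset.add_sum_erase (a := r₀) _ (fun r => (ξ.leg n r).dur) (Finset.mem_univ r₀),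
            show ((ξ.state n).pos r₀).dur = 0 from h₀, zero_add, add_comm]
          exact add_le_add (hδ _ h₀.isLeg) (Finset.sum_le_sum fun r _ => hle r)
        · rw [add_zero]
          exact Finset.sum_le_sum fun r _ => hle r
      -- Each event earns a credit of δ, and the one for reaching `T` is never lost.
      have hη : (if T ≤ (ξ.state n).η then δ else 0) + δ ≤
          (if ∃ r, ξ.Ready (n + 1) r then δ else 0) +
          (if T ≤ (ξ.state (n + 1)).η then δ else 0) := by
        have hmono : (ξ.state n).η ≤ (ξ.state (n + 1)).η := by
          rw [ξ.elapsed_eq, ξ.elapsed_eq]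
          exact min_le_min_right _ (ξ.time_monotone n.le_succ)
        rcases ξ.exists_ready_or n with h | ⟨h, h'⟩
        · rw [if_pos h, add_comm]
          gcongr
          split_ifs with h1 h2 h2
          · exact le_rfl
          · exact absurd (h1.trans hmono) h2
          · exact zero_le
          · exact le_rfl
        · rw [if_neg (not_le.2 h), if_pos h', zero_add]
          exact le_add_self
      rw [hS, Nat.cast_succ, add_mul, one_mul]
      calc n * δ + δ ≤ (Fintype.card R * ξ.time n + (∑ r, ((ξ.state n).pos r).dur +
            (if ∃ r, ξ.Ready n r then δ else 0))) +
            ((if T ≤ (ξ.state n).η then δ else 0) + δ) := by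
              rw [← add_assoc, ← add_assoc]; gcongr
        _ ≤ (Fintype.card R * ξ.time n + ∑ r, (ξ.leg n r).dur) +
            ((if ∃ r, ξ.Ready (n + 1) r then δ else 0) +
              (if T ≤ (ξ.state (n + 1)).η then δ else 0)) := by gcongr
        _ = _ := (add_assoc _ _ _).symm
  refine key.trans ?_
  rw [add_assoc _ (ite _ _ _), two_mul]
  gcongr <;> split_ifs <;> simp

/-- Infinitely many events take infinitely long. -/
theorem exists_lt_time (hW : W.Finite) (hpos : ∀ τ ∈ W, 0 < τ) (t : ℝ≥0) :
    ∃ n, t < ξ.time n := by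
  obtain ⟨δ, D, hδ, hl⟩ := exists_legDur_bounds (G := G) hW hpos
  by_contra! hcon
  have hD : ∀ n r, ((ξ.state n).pos r).dur ≤ D := by
    intro n r
    cases n with
    | zero => simp [ξ.init, initState]
    | succ n =>
      rw [ξ.pos_succ]
      obtain ⟨l, hl', -, -, h⟩ := ξ.exists_isLeg n r
      exact tsub_le_self.trans (h.trans (hl l hl').2)
  -- With event times bounded by t and remaining durations by D, linear growth bounds n * δ by this
  -- numerator.
  obtain ⟨n, hn⟩ := exists_nat_gt ((Fintype.card R * t + Fintype.card R * D + 2 * δ) / δ)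
  rw [div_lt_iff₀ hδ] at hn
  refine absurd (hn.trans_le ((ξ.linear_growth (fun l h => (hl l h).1) n).trans ?_)) (lt_irrefl _)
  gcongr
  · exact hcon n
  · calc ∑ r, ((ξ.state n).pos r).dur ≤ ∑ _r : R, D := Finset.sum_le_sum fun r _ => hD n r
      _ = _ := by simp

theorem exists_time_le_lt (hW : W.Finite) (hpos : ∀ τ ∈ W, 0 < τ) (t : ℝ≥0) :
    ∃ n, ξ.time n ≤ t ∧ t < ξ.time (n + 1) := by
  classical
  have h := ξ.exists_lt_time hW hpos t
  obtain ⟨n, hn⟩ : ∃ n, Nat.find h = n + 1 := Nat.exists_eq_succ_of_ne_zero fun h0 => by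
    have := Nat.find_spec h
    rw [h0, time_zero] at this
    exact not_lt_zero this
  exact ⟨n, not_lt.1 (Nat.find_min h (hn ▸ n.lt_succ_self)), hn ▸ Nat.find_spec h⟩

/-! ### The strategy described by a trajectory -/

/-- The position of robot `r` at time `t`, computed from its leg after the `n`-th event. -/
noncomputable def posAt (n : ℕ) (r : R) (t : ℝ≥0) : V → ℝ :=
  G.point (ξ.leg n r).src (ξ.leg n r).dst ((ξ.leg n r).dur - (t - ξ.time n))

/-- A completed leg ends where the next one begins; an unfinished leg simply continues. -/
theorem posAt_succ (n : ℕ) (r : R) :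
    ξ.posAt n r (ξ.time (n + 1)) = ξ.posAt (n + 1) r (ξ.time (n + 1)) := by
  simp only [posAt, tsub_self, tsub_zero]
  rw [time_succ, add_tsub_cancel_left]
  have hp := ξ.pos_succ n r
  by_cases h : ξ.Ready (n + 1) r
  · rw [h.isLeg.point_dur, h.leg_src, hp]
    rw [Ready, hp] at h
    rw [show (ξ.leg n r).dur - ξ.gap n = 0 from h, point_zero]
  · rw [ξ.leg_of_not_ready h, hp]

theorem posAt_eq_posAt (hpos : ∀ τ ∈ W, 0 < τ) {m n : ℕ} {r : R} {t : ℝ≥0}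
    (hm : ξ.time m ≤ t) (hm' : t ≤ ξ.time (m + 1)) (hn : ξ.time n ≤ t)
    (hn' : t ≤ ξ.time (n + 1)) : ξ.posAt m r t = ξ.posAt n r t := by
  wlog hmn : m ≤ n generalizing m n
  · exact (this hn hn' hm hm' (not_le.1 hmn).le).symm
  rcases hmn.eq_or_lt with rfl | hlt
  · rfl
  · have h1 : n ≤ m + 1 := (ξ.time_strictMono hpos).le_iff_le.1 (hn.trans hm')
    obtain rfl : n = m + 1 := le_antisymm h1 hlt
    obtain rfl : t = ξ.time (m + 1) := le_antisymm hm' hn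
    exact ξ.posAt_succ m r

/-- The event intervals cover all times and meet only at common endpoints, where the two position
formulas agree. -/
theorem existsUnique_describes (hW : W.Finite) (hpos : ∀ τ ∈ W, 0 < τ) :
    ∃! γ : Strategy G R, ξ.Describes γ := by
  choose N hN hN' using ξ.exists_time_le_lt hW hpos
  have hmem : ∀ r t, (∃ v, ξ.posAt (N t) r t = vertex v) ∨
      ∃ u v, G.graph.Adj u v ∧ ξ.posAt (N t) r t ∈ segment ℝ (vertex u) (vertex v) := by
    intro r t
    obtain ⟨l, hl, h1, h2, h3⟩ := ξ.exists_isLeg (N t) r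
    rw [posAt, ← h1, ← h2]
    exact hl.point_mem (tsub_le_self.trans h3)
  refine ⟨fun r t => ⟨ξ.posAt (N t) r t, hmem r t⟩, ?_, ?_⟩
  · intro n r t h h'
    exact ξ.posAt_eq_posAt hpos (hN t) (hN' t).le h h'
  · intro γ hγ
    funext r t
    exact Subtype.ext (hγ (N t) r t (hN t) (hN' t).le)

end Trajectory


theorem legStart_succ {V : Type*} (α : ℕ → Leg V) (j : ℕ) :
    legStart α (j + 1) = legStart α j + (α j).dur := by
  simp [legStart, Finset.sum_range_succ]

/-! ### From trajectories to sequences of legs -/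

namespace Trajectory

variable {V R : Type*} [Fintype V] [Fintype R] [Nonempty R] {G : WGraph V} {T : ℝ≥0}
  {W : Set ℝ≥0} {p₀ : R → V} (ξ : Trajectory G T W p₀)

/-- The completion time of a leg, remaining duration plus current time, is invariant until the robot
is ready again. -/
theorem leg_eq_of_not_ready {r : R} {m n : ℕ} (hmn : m ≤ n)
    (h : ∀ k, m < k → k ≤ n → ¬ ξ.Ready k r) :
    (ξ.leg n r).src = (ξ.leg m r).src ∧ (ξ.leg n r).dst = (ξ.leg m r).dst ∧
      (ξ.leg n r).dur + ξ.time n = (ξ.leg m r).dur + ξ.time m := by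
  induction n, hmn using Nat.le_induction with
  | base => exact ⟨rfl, rfl, rfl⟩
  | succ n hmn ih =>
    obtain ⟨h1, h2, h3⟩ := ih fun k hk hk' => h k hk (hk'.trans n.le_succ)
    rw [ξ.leg_of_not_ready (h (n + 1) (Nat.lt_succ_of_le hmn) le_rfl), ξ.pos_succ]
    refine ⟨h1, h2, ?_⟩
    rw [← h3, time_succ, add_comm (ξ.time n), ← add_assoc,
      tsub_add_cancel_of_le (ξ.gap_le_dur n r)]

/-- Otherwise the fixed completion time of the current leg would bound all event times. -/
theorem exists_ready_gt (hW : W.Finite) (hpos : ∀ τ ∈ W, 0 < τ) (r : R) (m : ℕ) :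
    ∃ n, m < n ∧ ξ.Ready n r := by
  by_contra! hcon
  obtain ⟨n, hn⟩ := ξ.exists_lt_time hW hpos ((ξ.leg m r).dur + ξ.time m)
  have hmn : m ≤ n := by
    by_contra! h
    exact absurd (hn.trans_le (ξ.time_monotone h.le)) (not_lt.2 le_add_self)
  have := (ξ.leg_eq_of_not_ready hmn fun k hk _ => hcon k hk).2.2
  exact absurd hn (not_lt.2 (this ▸ le_add_self))

/-- The next event at which the robot chooses a new leg, and its legs until then. -/
theorem exists_next_ready (hW : W.Finite) (hpos : ∀ τ ∈ W, 0 < τ) (r : R) (m : ℕ) :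
    ∃ n, m < n ∧ ξ.Ready n r ∧ ((ξ.state n).pos r).dst = (ξ.leg m r).dst ∧
      ∀ k, m ≤ k → k < n → (ξ.leg k r).src = (ξ.leg m r).src ∧
        (ξ.leg k r).dst = (ξ.leg m r).dst ∧ (ξ.leg k r).dur + ξ.time k = ξ.time n := by
  classical
  have hex := ξ.exists_ready_gt hW hpos r m
  obtain ⟨n, hn⟩ : ∃ n, Nat.find hex = n + 1 :=
    Nat.exists_eq_succ_of_ne_zero (Nat.ne_of_gt (Nat.zero_lt_of_lt (Nat.find_spec hex).1))
  have hspec := Nat.find_spec hex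
  have hmin : ∀ k, m < k → k ≤ n → ¬ ξ.Ready k r := fun k hk hk' hr =>
    Nat.find_min hex (hn ▸ Nat.lt_succ_of_le hk') ⟨hk, hr⟩
  rw [hn] at hspec
  have hmn : m ≤ n := Nat.lt_succ_iff.1 hspec.1
  obtain ⟨h1, h2, h3⟩ := ξ.leg_eq_of_not_ready hmn hmin
  -- The robot is ready at n + 1, so the remaining leg after event n exactly fills the gap.
  have hdur : (ξ.leg n r).dur = ξ.gap n := by
    have := hspec.2
    rw [Ready, pos_succ] at this
    exact le_antisymm (tsub_eq_zero_iff_le.1 this) (ξ.gap_le_dur n r)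
  refine ⟨n + 1, hspec.1, hspec.2, by rw [pos_succ]; exact h2, fun k hk hk' => ?_⟩
  obtain ⟨h1', h2', h3'⟩ := ξ.leg_eq_of_not_ready hk fun l hl hl' =>
    hmin l hl (hl'.trans (Nat.lt_succ_iff.1 hk'))
  exact ⟨h1', h2', by rw [h3', ← h3, hdur, time_succ, add_comm]⟩

theorem exists_time_mem_Icc {m n : ℕ} (hmn : m < n) {t : ℝ≥0} (h : ξ.time m ≤ t)
    (h' : t ≤ ξ.time n) : ∃ k, m ≤ k ∧ k < n ∧ ξ.time k ≤ t ∧ t ≤ ξ.time (k + 1) := by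
  induction n, Nat.succ_le_of_lt hmn using Nat.le_induction with
  | base => exact ⟨m, le_rfl, Nat.lt_succ_self m, h, h'⟩
  | succ n hn ih =>
    rcases le_total t (ξ.time n) with ht | ht
    · obtain ⟨k, h1, h2, h3⟩ := ih hn ht
      exact ⟨k, h1, h2.trans n.lt_succ_self, h3⟩
    · exact ⟨n, (Nat.lt_of_succ_le hn).le, n.lt_succ_self, ht, h'⟩

variable {ξ}

/-- The full legs of a robot are those at its ready events, enumerated by iterating `next` from
event 0; the j-th leg starts at the time of the j-th such event. -/
theorem Describes.mem_rationalStrategies (hW : W.Finite) (hpos : ∀ τ ∈ W, 0 < τ)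
    {γ : Strategy G R} (h : ξ.Describes γ) : γ ∈ rationalStrategies G W p₀ := by
  intro r
  choose next hlt hready hdst hleg using ξ.exists_next_ready hW hpos r
  have hsucc : ∀ j, next^[j + 1] 0 = next (next^[j] 0) := fun j =>
    Function.iterate_succ_apply' next j 0
  have hr : ∀ j, ξ.Ready (next^[j] 0) r := by
    intro j
    cases j with
    | zero => exact ξ.ready_zero r
    | succ j => rw [hsucc]; exact hready _
  have hstart : ∀ j, legStart (fun j => ξ.leg (next^[j] 0) r) j = ξ.time (next^[j] 0) := by
    intro j
    induction j with
    | zero => simp [legStart, time_zero]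
    | succ j ih =>
      rw [legStart_succ, ih, hsucc, add_comm]
      exact (hleg _ _ le_rfl (hlt _)).2.2
  refine ⟨fun j => ξ.leg (next^[j] 0) r, ?_, fun j => (hr j).isLeg, fun j => ?_, ?_⟩
  · rw [(hr 0).leg_src, Function.iterate_zero, id, ξ.init]
    rfl
  · rw [(hr (j + 1)).leg_src, hsucc]
    exact hdst _
  · intro j t ht ht'
    rw [hstart] at ht ht' ⊢
    rw [hsucc] at ht' ⊢
    obtain ⟨k, h1, h2, h3, h4⟩ := ξ.exists_time_mem_Icc (hlt _) ht ht'
    obtain ⟨e1, e2, e3⟩ := hleg _ k h1 h2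
    refine (h k r t h3 h4).trans ?_
    change G.point (ξ.leg k r).src (ξ.leg k r).dst _ = _
    rw [e1, e2, ← e3, ← tsub_tsub_eq_add_tsub_of_le h3]
    rfl

end Trajectory

/-! ### From sequences of legs to trajectories -/

section Follow

variable {V R : Type*} [Fintype V] [Fintype R] [Nonempty R] {G : WGraph V} {T : ℝ≥0}
  {W : Set ℝ≥0} {p₀ : R → V}

open Classical in
/-- The joint action by which every robot that is ready starts its next leg, where `k r` legs
of robot `r` have been started before. -/
noncomputable def followAction (α : R → ℕ → Leg V) (x : MState V R × (R → ℕ)) :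
    JointAction V R :=
  fun r => if (x.1.pos r).dur = 0 then some ((α r (x.2 r)).dst, (α r (x.2 r)).dur) else none

open Classical in
/-- States together with the numbers of legs that have been started, when every robot `r`
performs the legs `α r`. -/
noncomputable def followState (G : WGraph V) (T : ℝ≥0) (p₀ : R → V) (α : R → ℕ → Leg V) :
    ℕ → MState V R × (R → ℕ)
  | 0 => (initState p₀, 0)
  | n + 1 => (step G T (followState G T p₀ α n).1 (followAction α (followState G T p₀ α n)),
      fun r => if ((followState G T p₀ α n).1.pos r).dur = 0 then
        (followState G T p₀ α n).2 r + 1 else (followState G T p₀ α n).2 r)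

/-- The time of the `n`-th event when every robot `r` performs the legs `α r`. -/
noncomputable def followTime (G : WGraph V) (T : ℝ≥0) (p₀ : R → V) (α : R → ℕ → Leg V)
    (n : ℕ) : ℝ≥0 :=
  ∑ i ∈ Finset.range n,
    eventGap T (followState G T p₀ α i).1 (followAction α (followState G T p₀ α i))

variable {α : R → ℕ → Leg V}

/-- The first conjunct makes the next leg an admissible action. The second identifies the current
leg as the one last started, with its true completion time and a start no later than the current
event. -/
theorem followState_invariant (h0 : ∀ r, (α r 0).src = p₀ r)
    (hsrc : ∀ r j, (α r (j + 1)).src = (α r j).dst) (n : ℕ) (r : R) :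
    (((followState G T p₀ α n).1.pos r).dur = 0 →
      ((followState G T p₀ α n).1.pos r).dst = (α r ((followState G T p₀ α n).2 r)).src) ∧
    ∃ j, (followState G T p₀ α (n + 1)).2 r = j + 1 ∧
      (applyAction (followState G T p₀ α n).1 (followAction α (followState G T p₀ α n)) r).src =
        (α r j).src ∧
      (applyAction (followState G T p₀ α n).1 (followAction α (followState G T p₀ α n)) r).dst =
        (α r j).dst ∧
      (applyAction (followState G T p₀ α n).1 (followAction α (followState G T p₀ α n)) r).dur +
        followTime G T p₀ α n = legStart (α r) (j + 1) ∧
      legStart (α r) j ≤ followTime G T p₀ α n := by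
  -- The case of a robot starting a leg, shared by the base case and the induction step.
  have hready : ∀ n, ((followState G T p₀ α n).1.pos r).dur = 0 →
      ((followState G T p₀ α n).1.pos r).dst = (α r ((followState G T p₀ α n).2 r)).src →
      followTime G T p₀ α n = legStart (α r) ((followState G T p₀ α n).2 r) →
      ∃ j, (followState G T p₀ α (n + 1)).2 r = j + 1 ∧
      (applyAction (followState G T p₀ α n).1 (followAction α (followState G T p₀ α n)) r).src =
        (α r j).src ∧
      (applyAction (followState G T p₀ α n).1 (followAction α (followState G T p₀ α n)) r).dst =
        (α r j).dst ∧
      (applyAction (followState G T p₀ α n).1 (followAction α (followState G T p₀ α n)) r).dur +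
        followTime G T p₀ α n = legStart (α r) (j + 1) ∧
      legStart (α r) j ≤ followTime G T p₀ α n := by
    intro n hd hs ht
    refine ⟨(followState G T p₀ α n).2 r, by simp [followState, hd], ?_⟩
    have : followAction α (followState G T p₀ α n) r =
        some ((α r ((followState G T p₀ α n).2 r)).dst,
          (α r ((followState G T p₀ α n).2 r)).dur) := if_pos hd
    simp only [applyAction, this]
    exact ⟨hs, trivial, by rw [ht, legStart_succ, add_comm], ht.ge⟩
  induction n with
  | zero =>
    have hs : ((followState G T p₀ α 0).1.pos r).dst =
        (α r ((followState G T p₀ α 0).2 r)).src := (h0 r).symm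
    exact ⟨fun _ => hs, hready 0 rfl hs (by simp [followTime, followState, legStart])⟩
  | succ n ih =>
    obtain ⟨-, j, hk, h1, h2, h3, h4⟩ := ih
    have hgap := eventGap_le T (followState G T p₀ α n).1
      (followAction α (followState G T p₀ α n)) r
    have hpos : (followState G T p₀ α (n + 1)).1.pos r =
        ⟨(α r j).src, (α r j).dst,
          (applyAction (followState G T p₀ α n).1 (followAction α (followState G T p₀ α n)) r).dur
          - eventGap T (followState G T p₀ α n).1
            (followAction α (followState G T p₀ α n))⟩ := by
      rw [← h1, ← h2]; rfl
    have htime : ((followState G T p₀ α (n + 1)).1.pos r).dur + followTime G T p₀ α (n + 1) =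
        legStart (α r) (j + 1) := by
      rw [hpos, ← h3, followTime, Finset.sum_range_succ, ← followTime,
        add_comm (followTime G T p₀ α n), ← add_assoc, tsub_add_cancel_of_le hgap]
    have hs : ((followState G T p₀ α (n + 1)).1.pos r).dst =
        (α r ((followState G T p₀ α (n + 1)).2 r)).src := by
      rw [hpos, hk, hsrc]
    refine ⟨fun _ => hs, ?_⟩
    by_cases hd : ((followState G T p₀ α (n + 1)).1.pos r).dur = 0
    · refine hready (n + 1) hd hs ?_
      rw [hk, ← htime, hd, zero_add]
    · refine ⟨j, by rw [followState]; simp [hd, hk], ?_⟩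
      have hact : followAction α (followState G T p₀ α (n + 1)) r = none := if_neg hd
      simp only [applyAction, hact]
      refine ⟨by rw [hpos], by rw [hpos], htime, h4.trans ?_⟩
      rw [followTime, followTime, Finset.sum_range_succ]
      exact le_self_add

theorem exists_describes_of_mem_rationalStrategies {γ : Strategy G R}
    (hγ : γ ∈ rationalStrategies G W p₀) : ∃ ξ : Trajectory G T W p₀, ξ.Describes γ := by
  choose α h0 hleg hsrc hγ' using hγ
  have hinv := followState_invariant (G := G) (T := T) h0 hsrc
  refine ⟨⟨fun n => (followState G T p₀ α n).1,
    fun n => followAction α (followState G T p₀ α n), rfl, fun n r => ?_, fun n => rfl⟩, ?_⟩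
  · by_cases hd : ((followState G T p₀ α n).1.pos r).dur = 0
    · rw [if_pos hd]
      refine ⟨_, _, if_pos hd, ?_⟩
      rw [(hinv n r).1 hd]
      exact hleg r _
    · rw [if_neg hd]
      exact if_neg hd
  · intro n r t ht ht'
    rw [Trajectory.time_succ] at ht'
    change followTime G T p₀ α n ≤ t at ht
    change t ≤ followTime G T p₀ α n + eventGap T (followState G T p₀ α n).1
      (followAction α (followState G T p₀ α n)) at ht'
    obtain ⟨-, j, -, h1, h2, h3, h4⟩ := hinv n r
    refine (hγ' r j t (h4.trans ht) (ht'.trans ?_)).trans ?_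
    · rw [← h3, add_comm]
      gcongr
      exact eventGap_le _ _ _ _
    · change _ = G.point (applyAction (followState G T p₀ α n).1
        (followAction α (followState G T p₀ α n)) r).src (applyAction (followState G T p₀ α n).1
        (followAction α (followState G T p₀ α n)) r).dst (_ - (t - followTime G T p₀ α n))
      rw [h1, h2, tsub_tsub_eq_add_tsub_of_le ht, ← h3]

end Follow


/-! ### Latencies -/

section Latency

variable {V R : Type*} {G : WGraph V} {γ : Strategy G R}

theorem vertex_injective : Function.Injective (vertex : V → V → ℝ) := by
  intro u v h
  by_contra hne
  have := congrFun h u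
  rw [vertex_apply_self, vertex_apply_of_ne hne] at this
  exact one_ne_zero this

theorem lastVisit_le (r : R) (v : V) (t : ℝ≥0) : lastVisit γ r v t ≤ t :=
  csSup_le' fun _ h => h.1

theorem lastVisit_mono (r : R) (v : V) {a t : ℝ≥0} (h : a ≤ t) :
    lastVisit γ r v a ≤ lastVisit γ r v t :=
  csSup_le_csSup' ⟨t, fun _ h => h.1⟩ fun _ h' => ⟨h'.1.trans h, h'.2⟩

variable [Fintype R]

theorem latency_eq_zero {r : R} {v : V} {t : ℝ≥0} (h : (γ r t).1 = vertex v) :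
    latency γ v t = 0 := by
  have h1 : t ≤ lastVisit γ r v t := le_csSup ⟨t, fun _ h => h.1⟩ ⟨le_rfl, h⟩
  exact tsub_eq_zero_of_le
    (h1.trans (Finset.le_sup (f := fun r => lastVisit γ r v t) (Finset.mem_univ r)))

theorem latency_le (v : V) {a t : ℝ≥0} (h : a ≤ t) :
    latency γ v t ≤ latency γ v a + (t - a) := by
  have h1 : (Finset.univ.sup fun r => lastVisit γ r v a) ≤
      Finset.univ.sup fun r => lastVisit γ r v t :=
    Finset.sup_mono_fun fun r _ => lastVisit_mono r v h
  refine (tsub_le_tsub_left h1 t).trans ?_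
  rw [latency, add_comm]
  exact tsub_le_tsub_add_tsub

theorem latency_eq_add {v : V} {a t : ℝ≥0} (h : a ≤ t)
    (hno : ∀ r t', a < t' → t' ≤ t → (γ r t').1 ≠ vertex v) :
    latency γ v t = latency γ v a + (t - a) := by
  have h1 : ∀ r, lastVisit γ r v t = lastVisit γ r v a := fun r => by
    refine congrArg sSup (Set.ext fun t' => ⟨fun h' => ⟨?_, h'.2⟩, fun h' => ⟨h'.1.trans h, h'.2⟩⟩)
    by_contra! hlt
    exact hno r t' hlt h'.1 h'.2
  have h2 : (Finset.univ.sup fun r => lastVisit γ r v a) ≤ a :=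
    Finset.sup_le fun r _ => lastVisit_le r v a
  simp only [latency, h1]
  rw [add_comm, tsub_add_tsub_cancel h h2]

theorem latency_zero (v : V) : latency γ v 0 = 0 := tsub_eq_zero_of_le zero_le

theorem worstLatency_le_iff [Fintype V] {t x : ℝ≥0} :
    worstLatency γ t ≤ x ↔ ∀ v, G.weight v * latency γ v t ≤ x := by
  simp [worstLatency]

end Latency

/-! ### Latencies and the tracker along a described strategy -/

namespace Trajectory

variable {V R : Type*} [Fintype V] [Fintype R] [Nonempty R] {G : WGraph V} {T : ℝ≥0}
  {W : Set ℝ≥0} {p₀ : R → V} {ξ : Trajectory G T W p₀} {γ : Strategy G R}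

theorem Describes.eq_posAt (h : ξ.Describes γ) {n : ℕ} {t : ℝ≥0} (ht : ξ.time n ≤ t)
    (ht' : t ≤ ξ.time (n + 1)) (r : R) : (γ r t).1 = ξ.posAt n r t := h n r t ht ht'

theorem Describes.eq_vertex_of_wait (h : ξ.Describes γ) {n : ℕ} {t : ℝ≥0} (ht : ξ.time n ≤ t)
    (ht' : t ≤ ξ.time (n + 1)) {r : R} {v : V} (hs : (ξ.leg n r).src = v)
    (hd : (ξ.leg n r).dst = v) : (γ r t).1 = vertex v := by
  rw [h.eq_posAt ht ht', posAt, hs, hd, point_self]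

/-- The strict lower bound on t excludes a robot that is just leaving its source; afterwards an edge
traversal meets a node only on completion. -/
theorem Describes.eq_vertex_iff (hpos : ∀ τ ∈ W, 0 < τ) (h : ξ.Describes γ) {n : ℕ} {t : ℝ≥0}
    (ht : ξ.time n < t) (ht' : t ≤ ξ.time (n + 1)) (r : R) (v : V) :
    (γ r t).1 = vertex v ↔ (ξ.leg n r).dst = v ∧
      ((ξ.leg n r).src = v ∨ (ξ.leg n r).dur = t - ξ.time n) := by
  rw [h.eq_posAt ht.le ht', posAt]
  have hgap : t - ξ.time n ≤ (ξ.leg n r).dur := by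
    refine le_trans ?_ (ξ.gap_le_dur n r)
    rw [time_succ] at ht'
    exact tsub_le_iff_left.2 ht'
  obtain ⟨l, hl, h1, h2, h3⟩ := ξ.exists_isLeg n r
  rw [← h1, ← h2]
  rcases hl with ⟨hadj, hlen⟩ | ⟨he, -⟩
  · rw [point_eq_vertex_iff hadj, tsub_eq_zero_iff_le]
    constructor
    · rintro (⟨hle, rfl⟩ | ⟨heq, -⟩)
      · exact ⟨rfl, Or.inr (le_antisymm hle hgap)⟩
      · have : (ξ.leg n r).dur - (t - ξ.time n) < (ξ.leg n r).dur :=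
          tsub_lt_self (ξ.leg_dur_pos hpos n r) (tsub_pos_of_lt ht)
        rw [heq, ← hlen] at this
        exact absurd this (not_lt.2 h3)
    · rintro ⟨rfl, h' | h'⟩
      · exact absurd h' hadj.ne
      · exact Or.inl ⟨h'.le, rfl⟩
  · rw [he, point_self, vertex_injective.eq_iff]
    exact ⟨fun h' => ⟨h', Or.inl h'⟩, fun h' => h'.1⟩

theorem Describes.lat_eq (hpos : ∀ τ ∈ W, 0 < τ) (h : ξ.Describes γ) (n : ℕ) (v : V) :
    (ξ.state n).lat v = latency γ v (ξ.time n) := by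
  classical
  induction n with
  | zero => rw [ξ.init, time_zero, latency_zero]; rfl
  | succ n ih =>
    have hlt : ξ.time n < ξ.time (n + 1) := ξ.time_strictMono hpos n.lt_succ_self
    have hsub : ξ.time (n + 1) - ξ.time n = ξ.gap n := by
      rw [time_succ, add_tsub_cancel_left]
    rw [ξ.next]
    change (if ∃ r, (ξ.leg n r).dst = v ∧ ((ξ.leg n r).src = v ∨ (ξ.leg n r).dur = ξ.gap n)
      then 0 else (ξ.state n).lat v + ξ.gap n) = _
    split_ifs with hv
    · obtain ⟨r, hr⟩ := hv
      rw [← hsub, ← h.eq_vertex_iff hpos hlt le_rfl] at hr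
      exact (latency_eq_zero hr).symm
    · rw [latency_eq_add hlt.le, hsub, ih]
      intro r t ht ht' hγ
      rw [h.eq_vertex_iff hpos ht ht'] at hγ
      -- A leg lasts at least until the next event, so an arrival within the interval must occur at
      -- its right end.
      refine hv ⟨r, hγ.1, hγ.2.imp_right fun h' => ?_⟩
      refine le_antisymm ?_ (ξ.gap_le_dur n r)
      rw [h', ← hsub]
      exact tsub_le_tsub_right ht' _

/-- Latencies grow at most at unit rate, and that of a node with a waiting robot stays 0. -/
theorem Describes.worstLatency_le_peak (hpos : ∀ τ ∈ W, 0 < τ) (h : ξ.Describes γ) {n : ℕ}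
    {t : ℝ≥0} (ht : ξ.time n ≤ t) (ht' : t ≤ ξ.time (n + 1)) :
    worstLatency γ t ≤ Finset.univ.sup fun v =>
      G.weight v * peakLat T (ξ.state n) (ξ.action n) v := by
  classical
  refine Finset.sup_mono_fun fun v _ => mul_le_mul_right ?_ _
  change _ ≤ (if ∃ r, (ξ.leg n r).src = v ∧ (ξ.leg n r).dst = v then 0
    else (ξ.state n).lat v + ξ.gap n)
  split_ifs with hv
  · obtain ⟨r, hs, hd⟩ := hv
    exact (latency_eq_zero (h.eq_vertex_of_wait ht ht' hs hd)).le
  · refine (latency_le v ht).trans ?_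
    rw [h.lat_eq hpos]
    rw [time_succ] at ht'
    exact add_le_add_right (tsub_le_iff_left.2 ht') _

/-- The peaks are limits of latencies from the left. -/
theorem Describes.peak_le (hpos : ∀ τ ∈ W, 0 < τ) (h : ξ.Describes γ) {n : ℕ} {x : ℝ≥0∞}
    (hx : ∀ t, ξ.time n ≤ t → t ≤ ξ.time (n + 1) → (worstLatency γ t : ℝ≥0∞) ≤ x) :
    ((Finset.univ.sup fun v => G.weight v * peakLat T (ξ.state n) (ξ.action n) v : ℝ≥0) : ℝ≥0∞)
      ≤ x := by
  classical
  induction x with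
  | top => exact le_top
  | coe x =>
    simp only [ENNReal.coe_le_coe, worstLatency_le_iff, Finset.sup_le_iff] at hx ⊢
    intro v _
    change G.weight v * (if ∃ r, (ξ.leg n r).src = v ∧ (ξ.leg n r).dst = v then 0
      else (ξ.state n).lat v + ξ.gap n) ≤ x
    split_ifs with hv
    · rw [mul_zero]; exact zero_le
    -- The bound holds for all elapsed times below the gap and passes to the limit. It cannot be
    -- read off at the gap itself, where an arrival may reset the latency.
    · have hclosed : IsClosed {s : ℝ≥0 | G.weight v * ((ξ.state n).lat v + s) ≤ x} :=
        isClosed_le (by fun_prop) continuous_const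
      have hsub : Set.Iio (ξ.gap n) ⊆ {s | G.weight v * ((ξ.state n).lat v + s) ≤ x} := by
        intro s hs
        have h1 : ξ.time n + s ≤ ξ.time (n + 1) := by
          rw [time_succ]; exact add_le_add_right (le_of_lt hs) _
        have h2 := hx (ξ.time n + s) le_self_add h1 v
        rwa [latency_eq_add le_self_add, add_tsub_cancel_left, ← h.lat_eq hpos] at h2
        intro r t ht ht' hγ
        rw [h.eq_vertex_iff hpos ht (ht'.trans h1)] at hγ
        obtain ⟨hd, hs' | hdur⟩ := hγ
        · exact hv ⟨r, hs', hd⟩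
        · have := ξ.gap_le_dur n r
          rw [hdur] at this
          exact absurd (this.trans (tsub_le_iff_left.2 ht')) (not_le.2 hs)
      have := closure_minimal hsub hclosed
      rw [closure_Iio' (show (Set.Iio (ξ.gap n)).Nonempty from ⟨0, ξ.gap_pos hpos n⟩)] at this
      exact this (Set.mem_Iic.2 le_rfl)

/-- The tracker is the supremum of the worst weighted latency from time `T` on. -/
theorem Describes.z_le_iff (hpos : ∀ τ ∈ W, 0 < τ) (h : ξ.Describes γ) (n : ℕ) (x : ℝ≥0∞) :
    ((ξ.state n).z : ℝ≥0∞) ≤ x ↔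
      ∀ t, T ≤ t → t ≤ ξ.time n → (worstLatency γ t : ℝ≥0∞) ≤ x := by
  induction n with
  | zero =>
    have hz : (ξ.state 0).z = 0 := by rw [ξ.init]; rfl
    rw [hz, time_zero]
    refine ⟨fun _ t _ ht => ?_, fun _ => by simp⟩
    obtain rfl : t = 0 := le_antisymm ht zero_le
    have : worstLatency γ 0 ≤ 0 := worstLatency_le_iff.2 fun v => by simp [latency_zero]
    simp [le_antisymm this zero_le]
  | succ n ih =>
    have hmono := ξ.time_monotone n.le_succ
    have hη := ξ.elapsed_eq n
    rw [ξ.next]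
    change (((if T ≤ (ξ.state n).η then max (ξ.state n).z (Finset.univ.sup fun v =>
        G.weight v * peakLat T (ξ.state n) (ξ.action n) v)
      else if T ≤ (ξ.state n).η + ξ.gap n then Finset.univ.sup fun v =>
        G.weight v * (step G T (ξ.state n) (ξ.action n)).lat v else 0 : ℝ≥0)) : ℝ≥0∞) ≤ x ↔ _
    split_ifs with h1 h2
    · have hT : T ≤ ξ.time n := by rw [hη] at h1; exact h1.trans (min_le_left _ _)
      rw [ENNReal.coe_max, max_le_iff, ih]
      constructor
      · rintro ⟨h3, h4⟩ t ht ht'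
        rcases le_total t (ξ.time n) with h5 | h5
        · exact h3 t ht h5
        · exact (ENNReal.coe_le_coe.2 (h.worstLatency_le_peak hpos h5 ht')).trans h4
      · exact fun h3 => ⟨fun t ht ht' => h3 t ht (ht'.trans hmono),
          h.peak_le hpos fun t ht ht' => h3 t (hT.trans ht) ht'⟩
    -- The gap is cut so as not to overshoot `T`: the event time n + 1 is exactly `T`, the only time
    -- that the supremum covers so far.
    · have hle := ξ.gap_le_of_lt (not_le.1 h1)
      have hn : (ξ.state n).η = ξ.time n := by
        rw [hη]; exact min_eq_left (not_lt.1 fun h3 => h1 (by rw [hη, min_eq_right h3.le]))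
      rw [hn, ← time_succ] at hle h2
      have hz : (Finset.univ.sup fun v =>
          G.weight v * (step G T (ξ.state n) (ξ.action n)).lat v) =
          worstLatency γ (ξ.time (n + 1)) := by
        rw [← ξ.next]
        simp only [h.lat_eq hpos]
        rfl
      rw [hz]
      refine ⟨fun h3 t ht ht' => ?_, fun h3 => h3 _ h2 le_rfl⟩
      rwa [le_antisymm ht' (hle.trans ht)]
    · have hn : (ξ.state n).η = ξ.time n := by
        rw [hη]; exact min_eq_left (not_lt.1 fun h3 => h1 (by rw [hη, min_eq_right h3.le]))
      rw [hn, ← time_succ] at h2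
      exact ⟨fun _ t ht ht' => absurd (ht.trans ht') h2, fun _ => by simp⟩

theorem Describes.tailObjective_eq (hW : W.Finite) (hpos : ∀ τ ∈ W, 0 < τ)
    (h : ξ.Describes γ) : tailObjective T γ = ⨆ n, ((ξ.state n).z : ℝ≥0∞) := by
  refine eq_of_forall_ge_iff fun x => ?_
  simp only [tailObjective, iSup_le_iff, h.z_le_iff hpos]
  refine ⟨fun h' n t ht _ => h' t ht, fun h' t ht => ?_⟩
  obtain ⟨n, hn⟩ := ξ.exists_lt_time hW hpos t
  exact h' n t ht hn.le

end Trajectory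

end Monitoring

/-! ### Comparison of the two optimal values -/

open Monitoring

theorem mainTheorem8 {V R : Type*} [Fintype V] [Fintype R] [Nonempty R]
    (G : WGraph V) (T : ℝ≥0) (p₀ : R → V)
    (Δ : ℝ≥0) (hΔ : 0 < Δ) (κ : ℕ) (hκ : 1 ≤ κ) :
    -- the average reward of every stationary policy exists as a limit
    (∀ μ : Policy R G (waitSet Δ κ),
      Filter.Tendsto (meanReward G T p₀ μ) Filter.atTop (nhds (avgReward G T p₀ μ))) ∧
    -- both problems have optimal solutions, and their optimal values coincide
    (∃ μ : Policy R G (waitSet Δ κ), IsOptimalPolicy G T p₀ μ) ∧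
    (∃ γ : Strategy G R, IsOptimalStrategy G T (waitSet Δ κ) p₀ γ) ∧
    (⨅ μ : Policy R G (waitSet Δ κ), avgReward G T p₀ μ) =
      (⨅ γ ∈ rationalStrategies G (waitSet Δ κ) p₀, tailObjective T γ) ∧
    -- from optimal policies to optimal strategies
    (∀ μ : Policy R G (waitSet Δ κ), IsOptimalPolicy G T p₀ μ →
      (∃ ξ : Trajectory G T (waitSet Δ κ) p₀, ξ.GeneratedBy μ) ∧
      ∀ ξ : Trajectory G T (waitSet Δ κ) p₀, ξ.GeneratedBy μ →
        (∃! γ : Strategy G R, ξ.Describes γ) ∧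
        ∀ γ : Strategy G R, ξ.Describes γ → IsOptimalStrategy G T (waitSet Δ κ) p₀ γ) ∧
    -- from optimal strategies to optimal policies
    (∀ γ : Strategy G R, IsOptimalStrategy G T (waitSet Δ κ) p₀ γ →
      (∃ ξ : Trajectory G T (waitSet Δ κ) p₀, ξ.Describes γ) ∧
      ∀ ξ : Trajectory G T (waitSet Δ κ) p₀, ξ.Describes γ →
        ∃ μ : Policy R G (waitSet Δ κ), μ.ReadOffFrom ξ ∧ IsOptimalPolicy G T p₀ μ) := by
  have hW := waitSet_finite Δ κ
  have hW' : (waitSet Δ κ).Nonempty := ⟨Δ, mem_waitSet hκ⟩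
  have hpos : ∀ τ ∈ waitSet Δ κ, 0 < τ := by
    rintro τ ⟨k, hk, -, rfl⟩
    exact mul_pos (by exact_mod_cast hk) hΔ
  have hlower : ∀ γ ∈ rationalStrategies G (waitSet Δ κ) p₀,
      value G T (waitSet Δ κ) (initState p₀) ≤ tailObjective T γ := by
    intro γ hγ
    obtain ⟨ξ, hξ⟩ := exists_describes_of_mem_rationalStrategies (T := T) hγ
    rw [hξ.tailObjective_eq hW hpos]
    exact ξ.value_init_le
  -- A single trajectory attaining the value provides both witnesses: the strategy it describes and
  -- a policy read off from it.
  obtain ⟨ξ₀, hξ₀⟩ := exists_trajectory_le_value (G := G) (T := T) hW hW' p₀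
  obtain ⟨γ₀, hγ₀, -⟩ := ξ₀.existsUnique_describes hW hpos
  have hγ₀' := hγ₀.mem_rationalStrategies hW hpos
  have hγ₀_le : tailObjective T γ₀ ≤ value G T (waitSet Δ κ) (initState p₀) := by
    rw [hγ₀.tailObjective_eq hW hpos]; exact hξ₀
  obtain ⟨μ₀, -, hμ₀⟩ := exists_readOffFrom hW' ξ₀
  have hμ₀_le := hμ₀.trans hξ₀
  refine ⟨fun μ => ?_, ⟨μ₀, fun μ => hμ₀_le.trans (value_init_le_avgReward μ)⟩,
    ⟨γ₀, hγ₀', fun γ hγ => hγ₀_le.trans (hlower γ hγ)⟩, ?_, ?_, ?_⟩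
  · rw [avgReward_eq_iSup]
    exact tendsto_meanReward μ
  · exact le_antisymm
      ((iInf_le _ μ₀).trans (hμ₀_le.trans (le_iInf₂ hlower)))
      ((iInf₂_le γ₀ hγ₀').trans (hγ₀_le.trans (le_iInf value_init_le_avgReward)))
  · intro μ hμ
    refine ⟨exists_generatedBy p₀ T μ, fun ξ hξ => ⟨ξ.existsUnique_describes hW hpos,
      fun γ hγ => ⟨hγ.mem_rationalStrategies hW hpos, fun γ' hγ' => ?_⟩⟩⟩
    refine le_trans ?_ (hlower γ' hγ')
    rw [hγ.tailObjective_eq hW hpos]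
    -- Optimality of `μ` enters only through comparison with `μ₀`, which shows that `μ` attains the
    -- value.
    exact iSup_le fun n => z_le_value_init_of_mem_support ((hμ μ₀).trans hμ₀_le)
      (hξ.state_mem_support n)
  · intro γ hγ
    refine ⟨exists_describes_of_mem_rationalStrategies hγ.1, fun ξ hξ => ?_⟩
    obtain ⟨μ, hread, hμ⟩ := exists_readOffFrom hW' ξ
    refine ⟨μ, hread, fun μ' => hμ.trans ?_⟩
    rw [← hξ.tailObjective_eq hW hpos]
    -- Likewise `γ` attains the value by comparison with `γ₀`, and the value bounds every policy
    -- from below.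
    exact ((hγ.2 γ₀ hγ₀').trans hγ₀_le).trans (value_init_le_avgReward μ')
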